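/- Let $\lambda = 2\cos(\pi/5)$ and let $G_5 \subseteq PSL_2(\mathbb R)$ be the Hecke group generated by $z\mapsto -1/z$ and $z \mapsto z+\lambda$; the matrices representing its elements have entries in $\mathbb Z[\lambda]$. For $\tau\in\mathbb Z[\lambda]$ let $G_0(\tau)$ be the subgroup of all elements of $G_5$ whose $(2,1)$-entry is a multiple of $\tau$ in $\mathbb Z[\lambda]$, and let $N(G_0(\tau))$ denote the normaliser of $G_0(\tau)$ in $PSL_2(\mathbb R)$. Let $\tau \in \mathbb Z[\lambda]$ be non-zero. Then $$N(G_0(\tau)) \subseteq G_0(\tau/h),$$ where $h$ is the largest positive integer dividing $4$ such that $h^2$ divides $\tau$ in $\mathbb Z[\lambda]$. -/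

import Mathlib

open Matrix

noncomputable section

namespace HeckeFive

/-- `λ = 2 cos (π / 5)`. -/
def lam : ℝ := 2 * Real.cos (Real.pi / 5)

/-- The ring `ℤ[λ]`, as a subring of `ℝ`. -/
abbrev Zlam : Subalgebra ℤ ℝ := Algebra.adjoin ℤ {lam}

/-- `PSL₂(ℝ)`, that is `SL₂(ℝ)` modulo its center `{±I}`. -/
abbrev PSL2R : Type := Matrix.ProjectiveSpecialLinearGroup (Fin 2) ℝ

/-- The projection `SL₂(ℝ) → PSL₂(ℝ)`. -/
abbrev proj : Matrix.SpecialLinearGroup (Fin 2) ℝ →* PSL2R :=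
  QuotientGroup.mk' (Subgroup.center (Matrix.SpecialLinearGroup (Fin 2) ℝ))

/-- The matrix of the inversion `z ↦ -1/z`. -/
def matS : Matrix.SpecialLinearGroup (Fin 2) ℝ :=
  ⟨!![0, -1; 1, 0], by simp [Matrix.det_fin_two]⟩

/-- The matrix of the translation `z ↦ z + λ`. -/
def matT : Matrix.SpecialLinearGroup (Fin 2) ℝ :=
  ⟨!![1, lam; 0, 1], by simp [Matrix.det_fin_two]⟩

/-- The Hecke group `G₅ ⊆ PSL₂(ℝ)`, generated by `z ↦ -1/z` and `z ↦ z + λ`. -/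
def G5 : Subgroup PSL2R := Subgroup.closure {proj matS, proj matT}

/-- The matrices representing elements of `G₅` have all their entries in `ℤ[λ]`. -/
theorem entry_mem_of_mem_G5 {A : Matrix.SpecialLinearGroup (Fin 2) ℝ} (hA : proj A ∈ G5)
    (i j : Fin 2) : A i j ∈ Zlam := by
  let K : Subgroup (Matrix.SpecialLinearGroup (Fin 2) ℝ) :=
    { carrier := {B | ∀ i j, B i j ∈ Zlam}
      one_mem' := by
        intro i j
        rw [Matrix.SpecialLinearGroup.coe_one, Matrix.one_apply]
        split_ifs
        · exact one_mem _
        · exact zero_mem _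
      mul_mem' := by
        intro B C hB hC i j
        rw [Matrix.SpecialLinearGroup.coe_mul, Matrix.mul_apply]
        exact sum_mem fun k _ => mul_mem (hB i k) (hC k j)
      inv_mem' := by
        intro B hB i j
        rw [Matrix.SpecialLinearGroup.SL2_inv_expl]
        have hB' : ∀ i j, B i j ∈ Zlam := hB
        fin_cases i <;> fin_cases j <;> simp [hB'] }
  have hlam : lam ∈ Zlam := Algebra.subset_adjoin rfl
  have hS : matS ∈ K := by
    intro i j
    fin_cases i <;> fin_cases j <;> simp [matS]
  have hT : matT ∈ K := by
    intro i j
    fin_cases i <;> fin_cases j <;> simp [matT, hlam]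
  have hle : G5 ≤ K.map proj := by
    refine (Subgroup.closure_le _).2 ?_
    rintro x (rfl | rfl)
    · exact ⟨matS, hS, rfl⟩
    · exact ⟨matT, hT, rfl⟩
  obtain ⟨B, hB, hBA⟩ := hle hA
  obtain ⟨r, hr, hr'⟩ := Matrix.SpecialLinearGroup.mem_center_iff.1 (QuotientGroup.eq.1 hBA)
  have hrZ : r ∈ Zlam := by
    have h : r ^ 2 = 1 := by simpa using hr
    rcases (by simpa using h : r = 1 ∨ r = -1) with rfl | rfl
    · exact one_mem _
    · exact neg_mem (one_mem _)
  have hC : B⁻¹ * A ∈ K := by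
    intro i j
    rw [← hr', Matrix.scalar_apply, Matrix.diagonal_apply]
    split_ifs
    · exact hrZ
    · exact zero_mem _
  have : A ∈ K := by simpa using K.mul_mem hB hC
  exact this i j

/-- `G₀(τ)`: the elements of `G₅` whose (2,1)-entry is a multiple of `τ` in `ℤ[λ]`.
The entry is defined up to sign, so the choice of the representing matrix `A` is immaterial. -/
def G0 (τ : Zlam) : Subgroup PSL2R where
  carrier := {g | g ∈ G5 ∧ ∃ A : Matrix.SpecialLinearGroup (Fin 2) ℝ,
    proj A = g ∧ ∃ z : Zlam, A 1 0 = (τ : ℝ) * z}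
  one_mem' := ⟨one_mem _, 1, map_one _, 0, by simp⟩
  mul_mem' := by
    rintro _ _ ⟨hg, A, rfl, z, hz⟩ ⟨hg', B, rfl, w, hw⟩
    refine ⟨mul_mem hg hg', A * B, map_mul _ _ _,
      z * ⟨B 0 0, entry_mem_of_mem_G5 hg' 0 0⟩ + ⟨A 1 1, entry_mem_of_mem_G5 hg 1 1⟩ * w, ?_⟩
    rw [Matrix.SpecialLinearGroup.coe_mul, Matrix.mul_apply, Fin.sum_univ_two, hz, hw]
    push_cast
    ring
  inv_mem' := by
    rintro _ ⟨hg, A, rfl, z, hz⟩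
    refine ⟨inv_mem hg, A⁻¹, map_inv _ _, -z, ?_⟩
    rw [Matrix.SpecialLinearGroup.SL2_inv_expl]
    simp [hz]

end HeckeFive

end

/-! Let `Γ` be the preimage of `G₅` in `SL₂(ℤ[λ])`. A matrix `A` normalising `G₀(τ)` is first shown
to lie in `Γ`; its (2,1)-entry `c` is then controlled by divisibility.

Membership (`ConjugatesPowers.mem`): `τ` divides some positive integer `N`, so `G₀(τ)` contains
every `X T^N X⁻¹` with `X ∈ Γ`, and `A` conjugates all of these into `Γ`. Every point of `ℙ¹(ℚ(λ))`
is a cusp of `Γ` (`exists_cusp`, by descent on the norm of a quadratic form). Hence multiplying `A`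
by `Γ` on both sides makes it triangular, and then of the form `z ↦ n z + b` with `b ∈ ℤ[λ]`; here
`n` is an integer because `Γ` contains only the translations by `ℤλ`. The images of the cusps `0`
and `1/λ` give the columns `(b, 1)` and `(n + bλ, λ)`, which must be first columns of elements of
`Γ`. The Farey pentagon (`Pos`, `Reduced`) describes such columns and forces `b ∈ ℤλ` and `n = 1`.

Divisibility: conjugating `T` gives `τ ∣ c²`; conjugating an element of `G₀(τ)` with (1,1)-entry `a`
gives `τ ∣ c(a² - 1)`. Explicit elements of `Γ`, adjusted by the Chinese remainder theorem, turn
this into `τ ∣ 4c` (`Normalizes.dvd_four_mul`). Since 2 is prime in `ℤ[λ]`, the two conditions give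
`τ ∣ hc` (`exists_isGreatest_dvd_mul`). -/

namespace HeckeFive

/-! ### The ring `ℤ[λ]` and its two real embeddings -/

/-- The ring `ℤ[λ]` with `λ² = 1 + λ`, as an abstract quadratic algebra. -/
abbrev O : Type := QuadraticAlgebra ℤ 1 1

/-- `SL₂(ℤ[λ])`. -/
abbrev SL : Type := Matrix.SpecialLinearGroup (Fin 2) O

/-- The `2 × 2` matrices over `ℤ[λ]`. -/
abbrev Mat : Type := Matrix (Fin 2) (Fin 2) O

/-- The generator `λ` of the abstract ring `ℤ[λ]`. -/
def w : O := ⟨0, 1⟩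

theorem w_sq : w ^ 2 = 1 + w := by decide

theorem lam_sq : lam ^ 2 = lam + 1 := by
  have h5 : Real.sqrt 5 ^ 2 = 5 := Real.sq_sqrt (by norm_num)
  rw [lam, Real.cos_pi_div_five]
  linear_combination h5 / 4

theorem lam_pos : 0 < lam :=
  mul_pos two_pos (Real.cos_pos_of_mem_Ioo ⟨by linarith [Real.pi_pos], by linarith [Real.pi_pos]⟩)

theorem lam_gt : 1.618 < lam := by
  nlinarith [lam_sq, lam_pos]

theorem lam_lt : lam < 1.6181 := by
  nlinarith [lam_sq, lam_pos]

/-- The embedding of `ℤ[λ]` in `ℝ` sending `λ` to `2 cos (π / 5)`. -/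
noncomputable def emb : O →+* ℝ where
  toFun z := z.re + z.im * lam
  map_one' := by simp [QuadraticAlgebra.re_one, QuadraticAlgebra.im_one]
  map_zero' := by simp
  map_add' x y := by simp; ring
  map_mul' x y := by
    simp
    linear_combination (-(x.im : ℝ) * y.im) * lam_sq

/-- The conjugate embedding of `ℤ[λ]` in `ℝ`, sending `λ` to `1 - 2 cos (π / 5)`. -/
noncomputable def conj : O →+* ℝ where
  toFun z := z.re + z.im * (1 - lam)
  map_one' := by simp [QuadraticAlgebra.re_one, QuadraticAlgebra.im_one]
  map_zero' := by simp
  map_add' x y := by simp; ring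
  map_mul' x y := by
    simp
    linear_combination (-(x.im : ℝ) * y.im) * lam_sq

theorem emb_apply (z : O) : emb z = z.re + z.im * lam := rfl

theorem conj_apply (z : O) : conj z = z.re + z.im * (1 - lam) := rfl

@[simp] theorem emb_w : emb w = lam := by simp [emb_apply, w]

@[simp] theorem conj_w : conj w = 1 - lam := by simp [conj_apply, w]

theorem emb_mul_conj (z : O) : emb z * conj z = (QuadraticAlgebra.norm z : ℤ) := by
  rw [emb_apply, conj_apply, QuadraticAlgebra.norm_def]
  push_cast
  linear_combination (-(z.im : ℝ) ^ 2) * lam_sq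

theorem lam_irrational : Irrational lam := by
  have h : lam = Real.goldenRatio := by
    rw [lam, Real.cos_pi_div_five, Real.goldenRatio]; ring
  rw [h]
  exact Real.goldenRatio_irrational

theorem int_of_add_mul_lam_eq {m n : ℤ} {q : ℚ} (h : (m : ℝ) + n * lam = q) : n = 0 := by
  by_contra hn
  refine lam_irrational ⟨(q - m) / n, ?_⟩
  have : (n : ℝ) ≠ 0 := by exact_mod_cast hn
  push_cast
  rw [div_eq_iff this]
  linarith

theorem emb_injective : Function.Injective emb := by
  rw [injective_iff_map_eq_zero]
  intro z hz
  have him : z.im = 0 := int_of_add_mul_lam_eq (q := 0) (by simpa [emb_apply] using hz)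
  have hre : z.re = 0 := by simpa [emb_apply, him] using hz
  ext <;> simp [him, hre]

theorem emb_eq_zero {z : O} : emb z = 0 ↔ z = 0 :=
  map_eq_zero_iff emb emb_injective

/-- An element of `ℤ[λ]` that is a rational number is an integer. -/
theorem exists_int_of_emb_eq_rat {z : O} {q : ℚ} (h : emb z = q) : ∃ n : ℤ, z = n := by
  refine ⟨z.re, ?_⟩
  have : z.im = 0 := int_of_add_mul_lam_eq (by simpa [emb_apply] using h)
  ext <;> simp [this]

instance : IsDomain O :=
  Function.Injective.isDomain emb emb_injective

theorem conj_injective : Function.Injective conj := by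
  rw [injective_iff_map_eq_zero]
  intro z hz
  have him : -z.im = 0 := int_of_add_mul_lam_eq (m := z.re + z.im) (q := 0) (by
    rw [conj_apply] at hz
    push_cast
    linarith)
  have hre : z.re = 0 := by simpa [conj_apply, neg_eq_zero.1 him] using hz
  ext <;> simp [neg_eq_zero.1 him, hre]

theorem conj_eq_zero {z : O} : conj z = 0 ↔ z = 0 :=
  map_eq_zero_iff conj conj_injective

theorem norm_ne_zero {z : O} (hz : z ≠ 0) : QuadraticAlgebra.norm z ≠ 0 := by
  intro h
  have := emb_mul_conj z
  rw [h, Int.cast_zero, mul_eq_zero, emb_eq_zero, conj_eq_zero] at this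
  tauto

/-! ### Generators of the Hecke group -/

/-- The matrix of the inversion over the abstract ring `ℤ[λ]`. -/
def S : SL := ⟨!![0, -1; 1, 0], by simp [det_fin_two]⟩

/-- The matrix of the translation over the abstract ring `ℤ[λ]`. -/
def T : SL := ⟨!![1, w; 0, 1], by simp [det_fin_two]⟩

/-- The lower unipotent matrix `S T⁻¹ S⁻¹`. -/
def U : SL := ⟨!![1, 0; w, 1], by simp [det_fin_two]⟩

/-- The preimage of the Hecke group in `SL₂(ℤ[λ])`. -/
def Γ : Subgroup (SL) := Subgroup.closure {S, T}

theorem S_mem : S ∈ Γ := Subgroup.subset_closure (by simp)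

theorem T_mem : T ∈ Γ := Subgroup.subset_closure (by simp)

theorem S_mul_S : S * S = -1 := by decide

theorem neg_one_mem : (-1 : SL) ∈ Γ := by
  rw [← S_mul_S]
  exact mul_mem S_mem S_mem

theorem neg_mem {X : SL} (hX : X ∈ Γ) : -X ∈ Γ := by
  rw [← neg_one_mul]
  exact mul_mem neg_one_mem hX

theorem U_eq : U = S * T⁻¹ * S⁻¹ := by decide

theorem U_mem : U ∈ Γ := by
  rw [U_eq]
  exact mul_mem (mul_mem S_mem (inv_mem T_mem)) (inv_mem S_mem)

theorem coe_T_zpow (k : ℤ) : ((T ^ k : SL) : Mat) = !![1, k * w; 0, 1] := by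
  have hinv : ((T⁻¹ : SL) : Mat) = !![1, -w; 0, 1] := by decide
  induction k using Int.induction_on with
  | zero =>
    rw [zpow_zero]
    refine Matrix.ext fun i j => ?_
    fin_cases i <;> fin_cases j <;> simp
  | succ n ih =>
    rw [_root_.zpow_add_one, Matrix.SpecialLinearGroup.coe_mul, ih, T]
    refine Matrix.ext fun i j => ?_
    fin_cases i <;> fin_cases j <;> simp [mul_apply, Fin.sum_univ_two] <;> ring
  | pred n ih =>
    rw [_root_.zpow_sub_one, Matrix.SpecialLinearGroup.coe_mul, ih, hinv]
    refine Matrix.ext fun i j => ?_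
    fin_cases i <;> fin_cases j <;> simp [mul_apply, Fin.sum_univ_two] <;> ring

theorem coe_U_zpow (k : ℤ) : ((U ^ k : SL) : Mat) = !![1, 0; k * w, 1] := by
  have hinv : ((U⁻¹ : SL) : Mat) = !![1, 0; -w, 1] := by decide
  induction k using Int.induction_on with
  | zero =>
    rw [zpow_zero]
    refine Matrix.ext fun i j => ?_
    fin_cases i <;> fin_cases j <;> simp
  | succ n ih =>
    rw [_root_.zpow_add_one, Matrix.SpecialLinearGroup.coe_mul, ih, U]
    refine Matrix.ext fun i j => ?_
    fin_cases i <;> fin_cases j <;> simp [mul_apply, Fin.sum_univ_two] <;> ring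
  | pred n ih =>
    rw [_root_.zpow_sub_one, Matrix.SpecialLinearGroup.coe_mul, ih, hinv]
    refine Matrix.ext fun i j => ?_
    fin_cases i <;> fin_cases j <;> simp [mul_apply, Fin.sum_univ_two] <;> ring

/-- The group `Γ` is generated by the two unipotent matrices. -/
theorem mem_closure_T_U {X : SL} (hX : X ∈ Γ) :
    X ∈ Subgroup.closure {T, U} := by
  have hT : T ∈ Subgroup.closure {T, U} := Subgroup.subset_closure (by simp)
  have hU : U ∈ Subgroup.closure {T, U} := Subgroup.subset_closure (by simp)
  have hle : Γ ≤ Subgroup.closure {T, U} := by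
    refine (Subgroup.closure_le _).2 ?_
    rintro x (rfl | rfl)
    -- Up to sign the word is `(T⁻¹ S)⁵ S⁻¹`, and `T⁻¹ S` has order five modulo `±1`. As `S⁻¹ = -S`,
    -- the disjunction covers both signs.
    · have h : S = T⁻¹ * U * T⁻¹ * U * T⁻¹ ∨ S = (T⁻¹ * U * T⁻¹ * U * T⁻¹)⁻¹ := by decide
      have h' : T⁻¹ * U * T⁻¹ * U * T⁻¹ ∈ Subgroup.closure {T, U} :=
        mul_mem (mul_mem (mul_mem (mul_mem (inv_mem hT) hU) (inv_mem hT)) hU) (inv_mem hT)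
      rcases h with h | h <;> rw [h]
      · exact h'
      · exact inv_mem h'
    · exact hT
  exact hle hX

/-! ### Every point of the projective line over `ℚ(λ)` is a cusp -/

/-- The quadratic form `a² - λab + b²`, invariant under the element `T S` of order five. -/
def Q (v : Fin 2 → O) : O := v 0 ^ 2 - w * v 0 * v 1 + v 1 ^ 2

theorem Q_TS_mulVec (v : Fin 2 → O) : Q (((T * S : SL) : Mat) *ᵥ v) = Q v := by
  have h : ((T * S : SL) : Mat) = !![w, -1; 1, 0] := by decide
  rw [h]
  simp [Q, mulVec, dotProduct, Fin.sum_univ_two]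
  ring

/-- Translating by the integral part of `x / λ` decreases the product of the form and its
conjugate. -/
theorem exists_translate_lt {x : ℝ} (y : ℝ) (hx : lam + 1 ≤ x) :
    ∃ k : ℤ, ((x - k * lam) ^ 2 - lam * (x - k * lam) + 1) *
        ((y - k * (1 - lam)) ^ 2 - (1 - lam) * (y - k * (1 - lam)) + 1) <
      (x ^ 2 - lam * x + 1) * (y ^ 2 - (1 - lam) * y + 1) := by
  have h1 := lam_gt
  have h2 := lam_lt
  have hsq := lam_sq
  obtain ⟨k, hk⟩ : ∃ k : ℤ, k = ⌊x / lam⌋ := ⟨_, rfl⟩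
  have hle : k * lam ≤ x := by
    rw [hk, ← le_div_iff₀ lam_pos]
    exact Int.floor_le _
  have hlt : x < (k + 1) * lam := by
    rw [hk, ← div_lt_iff₀ lam_pos]
    exact Int.lt_floor_add_one _
  have hk1 : (1 : ℤ) ≤ k := by
    have : (0 : ℝ) < k := by nlinarith
    exact_mod_cast this
  have hA : (x - k * lam) ^ 2 - lam * (x - k * lam) + 1 ≤ 1 := by nlinarith
  have hA0 : 0 ≤ (x - k * lam) ^ 2 - lam * (x - k * lam) + 1 := by
    nlinarith [sq_nonneg (2 * (x - k * lam) - lam)]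
  have hY : 0 < y ^ 2 - (1 - lam) * y + 1 := by nlinarith [sq_nonneg (2 * y - (1 - lam))]
  -- Complete the square around `(1 - λ)/2` and bound the cross term by AM-GM. The constant 0.43 is
  -- just above `(λ - 1)² / (1 - (λ - 1)²/4)`, which is about 0.422.
  have hB : (y - k * (1 - lam)) ^ 2 - (1 - lam) * (y - k * (1 - lam)) + 1 ≤
      (0.43 * k ^ 2 + 2) * (y ^ 2 - (1 - lam) * y + 1) := by
    have hc : (lam - 1) ^ 2 ≤ 0.43 * (1 - (lam - 1) ^ 2 / 4) := by nlinarith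
    have h3 := mul_le_mul_of_nonneg_left hc (sq_nonneg (k : ℝ))
    have h4 := sq_nonneg (lam - 1 - 0.43 * k * (y + (lam - 1) / 2))
    have h5 := sq_nonneg (y + (lam - 1) / 2)
    linarith
  -- For `k = 1` the value of the form at `kλ` is only 1, so the hypothesis `λ + 1 ≤ x` is needed;
  -- for `k ≥ 2` comparison with `kλ` suffices.
  have hF : 0.43 * (k : ℝ) ^ 2 + 2 < x ^ 2 - lam * x + 1 := by
    rcases hk1.eq_or_lt with h | h
    · rw [← h]
      push_cast
      nlinarith
    · have h' : (2 : ℝ) ≤ k := by exact_mod_cast h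
      have : (k * lam) ^ 2 - lam * (k * lam) + 1 ≤ x ^ 2 - lam * x + 1 := by
        have h4 : 0 ≤ (x - k * lam) * (x + k * lam - lam) :=
          mul_nonneg (by linarith) (by nlinarith)
        linarith
      have h3 : 2.6 * ((k : ℝ) ^ 2 - k) ≤ (k * lam) ^ 2 - lam * (k * lam) := by
        have : (k * lam) ^ 2 - lam * (k * lam) = (lam + 1) * ((k : ℝ) ^ 2 - k) := by
          rw [← hsq]; ring
        rw [this]
        exact mul_le_mul_of_nonneg_right (by linarith) (by nlinarith)
      have h4 : 0 ≤ (k : ℝ) * (k - 2) := mul_nonneg (by linarith) (by linarith)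
      linarith
  refine ⟨k, lt_of_le_of_lt ?_ (mul_lt_mul_of_pos_right hF hY)⟩
  have hB0 : 0 ≤ (0.43 * (k : ℝ) ^ 2 + 2) * (y ^ 2 - (1 - lam) * y + 1) := by positivity
  calc _ ≤ _ := mul_le_mul_of_nonneg_left hB hA0
    _ ≤ _ := mul_le_of_le_one_left hB0 hA

/-- A power of `T S` makes the second coordinate as small as its neighbours. -/
theorem exists_rotate (v : Fin 2 → O) :
    ∃ X ∈ Γ, Q ((X : Mat) *ᵥ v) = Q v ∧ |emb (((X : Mat) *ᵥ v) 1)| ≤ |emb (((X : Mat) *ᵥ v) 0)| ∧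
      |emb (((X : Mat) *ᵥ v) 1)| ≤ |lam * emb (((X : Mat) *ᵥ v) 1) - emb (((X : Mat) *ᵥ v) 0)| := by
  have hR : T * S ∈ Γ := mul_mem T_mem S_mem
  have h5 : T * S * (T * S) * (T * S) * (T * S) * (T * S) = -1 := by decide
  have h10 : (T * S) ^ 10 = 1 := by
    calc
      (T * S) ^ 10 = (T * S * (T * S) * (T * S) * (T * S) * (T * S)) ^ 2 := by
        simp only [pow_succ, pow_zero, one_mul, mul_assoc]
      _ = 1 := by rw [h5]; simp
  have hinv : (((T * S)⁻¹ : SL) : Mat) = !![0, 1; -1, w] := by decide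
  have hcoe : ((T * S : SL) : Mat) = !![w, -1; 1, 0] := by decide
  have hfin : (Set.range fun i : ℤ => |emb (((((T * S) ^ i : SL) : Mat) *ᵥ v) 1)|).Finite := by
    have hR10 : IsOfFinOrder (T * S) := isOfFinOrder_iff_pow_eq_one.2 ⟨10, by norm_num, h10⟩
    refine ((finite_zpowers.2 hR10).image fun X : SL => |emb (((X : Mat) *ᵥ v) 1)|).subset ?_
    rintro _ ⟨i, rfl⟩
    exact ⟨_, ⟨i, rfl⟩, rfl⟩
  obtain ⟨_, ⟨i, rfl⟩, hi⟩ := hfin.exists_minimal (Set.range_nonempty _)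
  have hmin : ∀ j : ℤ, |emb (((((T * S) ^ i : SL) : Mat) *ᵥ v) 1)| ≤ |emb (((((T * S) ^ j : SL) : Mat) *ᵥ v) 1)| := fun j =>
    (le_total _ _).elim id fun h => hi ⟨j, rfl⟩ h
  have hQ : ∀ j : ℤ, Q ((((T * S) ^ j : SL) : Mat) *ᵥ v) = Q v := by
    intro j
    induction j using Int.induction_on with
    | zero => simp
    | succ n ih =>
      rw [add_comm, _root_.zpow_one_add, Matrix.SpecialLinearGroup.coe_mul, ← mulVec_mulVec,
        Q_TS_mulVec, ih]
    | pred n ih =>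
      rw [← Q_TS_mulVec, mulVec_mulVec, ← Matrix.SpecialLinearGroup.coe_mul, ← _root_.zpow_one_add]
      simpa using ih
  refine ⟨(T * S) ^ i, zpow_mem hR i, hQ i, ?_, ?_⟩
  · refine (hmin (1 + i)).trans_eq ?_
    rw [_root_.zpow_one_add, Matrix.SpecialLinearGroup.coe_mul, ← mulVec_mulVec, hcoe]
    set u := (((T * S) ^ i : SL) : Mat) *ᵥ v
    simp [mulVec, dotProduct, Fin.sum_univ_two]
  · refine (hmin (-1 + i)).trans_eq ?_
    rw [_root_.zpow_add, _root_.zpow_neg_one, Matrix.SpecialLinearGroup.coe_mul, ← mulVec_mulVec, hinv]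
    set u := (((T * S) ^ i : SL) : Mat) *ᵥ v
    simp [mulVec, dotProduct, Fin.sum_univ_two]
    ring_nf

/-- The size of a vector of `ℤ[λ]²`: the absolute norm of the form `Q`. -/
def size (v : Fin 2 → O) : ℕ := (QuadraticAlgebra.norm (Q v)).natAbs

/-- A Euclidean step: rotate by a power of `T S`, which fixes `Q`, until the ratio `x` of the
coordinates is at distance at least 1 from both `0` and `λ`, then translate. Since `Q` is positive
definite in both embeddings, `size` is the product of its two real values, which depends on `x` and
its conjugate `y` up to a factor unchanged by translation. -/
theorem exists_size_lt {v : Fin 2 → O} (hv : ∀ X ∈ Γ, ((X : Mat) *ᵥ v) 1 ≠ 0) :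
    ∃ X ∈ Γ, size ((X : Mat) *ᵥ v) < size v := by
  obtain ⟨X, hX, hQ, h0, h1⟩ := exists_rotate v
  have hb := hv X hX
  set u := (X : Mat) *ᵥ v with hu
  have hsize : size v = size u := by rw [size, size, hQ]
  have hb1 : emb (u 1) ≠ 0 := emb_eq_zero.not.2 hb
  have hb2 : conj (u 1) ≠ 0 := conj_eq_zero.not.2 hb
  have hsz : ∀ z : Fin 2 → O, z 1 = u 1 → ((size z : ℕ) : ℝ) =
      (emb (u 1) * conj (u 1)) ^ 2 *
        (((emb (z 0) / emb (u 1)) ^ 2 - lam * (emb (z 0) / emb (u 1)) + 1) *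
        ((conj (z 0) / conj (u 1)) ^ 2 - (1 - lam) * (conj (z 0) / conj (u 1)) + 1)) := by
    intro z hz
    have hpos : 0 ≤ emb (Q z) * conj (Q z) := by
      have e1 : 0 ≤ emb (Q z) := by
        simp [Q]
        nlinarith [sq_nonneg (2 * emb (z 0) - lam * emb (z 1)), sq_nonneg (emb (z 1)), lam_lt,
          lam_gt, lam_sq]
      have e2 : 0 ≤ conj (Q z) := by
        simp [Q]
        nlinarith [sq_nonneg (2 * conj (z 0) - (1 - lam) * conj (z 1)), sq_nonneg (conj (z 1)),
          lam_lt, lam_gt, lam_sq]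
      positivity
    rw [emb_mul_conj] at hpos
    have : ((size z : ℕ) : ℝ) = emb (Q z) * conj (Q z) := by
      rw [emb_mul_conj, size, ← Int.cast_natCast, Int.natCast_natAbs,
        abs_of_nonneg (by exact_mod_cast hpos)]
    rw [this, Q, hz]
    simp only [map_add, map_sub, map_mul, map_pow, emb_w, conj_w]
    field_simp
  have key : ∃ k : ℤ, size (((T ^ (-k) : SL) : Mat) *ᵥ u) < size u := by
    have hk : ∀ k : ℤ, (((T ^ (-k) : SL) : Mat) *ᵥ u) 1 = u 1 ∧
        (((T ^ (-k) : SL) : Mat) *ᵥ u) 0 = u 0 - k * w * u 1 := by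
      intro k
      rw [coe_T_zpow]
      simp [mulVec, dotProduct, Fin.sum_univ_two]
      ring
    set x := emb (u 0) / emb (u 1) with hx
    set y := conj (u 0) / conj (u 1) with hy
    have hpos : 0 < (emb (u 1) * conj (u 1)) ^ 2 := by positivity
    have hx0 : 1 ≤ |x| := by
      rw [hx, abs_div, one_le_div (abs_pos.2 hb1)]
      exact h0
    have hx1 : 1 ≤ |lam - x| := by
      have : lam - x = (lam * emb (u 1) - emb (u 0)) / emb (u 1) := by
        rw [hx]; field_simp
      rw [this, abs_div, one_le_div (abs_pos.2 hb1)]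
      exact h1
    have hxk : ∀ k : ℤ, emb ((((T ^ (-k) : SL) : Mat) *ᵥ u) 0) / emb (u 1) = x - k * lam := by
      intro k
      rw [(hk k).2, hx]
      simp
      field_simp
    have hyk : ∀ k : ℤ, conj ((((T ^ (-k) : SL) : Mat) *ᵥ u) 0) / conj (u 1) = y - k * (1 - lam) := by
      intro k
      rw [(hk k).2, hy]
      simp
      field_simp
    suffices ∃ k : ℤ, ((x - k * lam) ^ 2 - lam * (x - k * lam) + 1) *
        ((y - k * (1 - lam)) ^ 2 - (1 - lam) * (y - k * (1 - lam)) + 1) <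
        (x ^ 2 - lam * x + 1) * (y ^ 2 - (1 - lam) * y + 1) by
      obtain ⟨k, h⟩ := this
      refine ⟨k, ?_⟩
      have h' := mul_lt_mul_of_pos_left h hpos
      rw [← hxk, ← hyk, ← hsz _ (hk k).1, ← hsz u rfl] at h'
      exact_mod_cast h'
    have h2 := lam_gt
    have h3 := lam_lt
    -- The interval `[1, λ - 1]` is empty. The remaining cases are exchanged by `x ↦ λ - x`, `y ↦ 1
    -- - λ - y`, which preserves both forms.
    have hcase : lam + 1 ≤ x ∨ lam + 1 ≤ lam - x := by
      rcases le_abs.1 hx0 with h | h <;> rcases le_abs.1 hx1 with h' | h'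
      · linarith
      · left; linarith
      · right; linarith
      · right; linarith
    rcases hcase with h | h
    · exact exists_translate_lt y h
    · obtain ⟨k, hk⟩ := exists_translate_lt (1 - lam - y) h
      refine ⟨-k, ?_⟩
      push_cast
      ring_nf at hk ⊢
      exact hk
  obtain ⟨k, hk⟩ := key
  refine ⟨T ^ (-k) * X, mul_mem (zpow_mem T_mem _) hX, ?_⟩
  rwa [Matrix.SpecialLinearGroup.coe_mul, ← mulVec_mulVec, hsize]

theorem exists_mulVec_one_eq_zero (v : Fin 2 → O) : ∃ X ∈ Γ, ((X : Mat) *ᵥ v) 1 = 0 := by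
  induction h : size v using Nat.strong_induction_on generalizing v with
  | _ n ih =>
    by_contra! hv
    obtain ⟨X, hX, hlt⟩ := exists_size_lt hv
    obtain ⟨Y, hY, h0⟩ := ih _ (h ▸ hlt) _ rfl
    refine hv (Y * X) (mul_mem hY hX) ?_
    rwa [Matrix.SpecialLinearGroup.coe_mul, ← mulVec_mulVec]

/-- Every element of `ℙ¹(ℚ(λ))` is a cusp of the Hecke group `G₅`. -/
theorem exists_cusp (a b : O) : ∃ X ∈ Γ, ∃ e : O, a = X 0 0 * e ∧ b = X 1 0 * e := by
  obtain ⟨X, hX, h0⟩ := exists_mulVec_one_eq_zero ![a, b]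
  simp [mulVec, dotProduct, Fin.sum_univ_two] at h0
  have hdet := X.2
  rw [det_fin_two] at hdet
  refine ⟨X⁻¹, inv_mem hX, X 0 0 * a + X 0 1 * b, ?_, ?_⟩
  · rw [Matrix.SpecialLinearGroup.SL2_inv_expl]
    simp
    linear_combination (-a) * hdet - X 0 1 * h0
  · rw [Matrix.SpecialLinearGroup.SL2_inv_expl]
    simp
    linear_combination (-b) * hdet + X 0 0 * h0

/-! ### The orbit of the first basis vector, by the Farey pentagon -/

/-- The vectors generated from the standard basis by the four nonnegative matrices that
subdivide a side of the Farey pentagon of the Hecke group `G₅`. -/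
inductive Pos : O → O → Prop
  | e1 : Pos 1 0
  | e2 : Pos 0 1
  | a1 {x y : O} : Pos x y → Pos (x + w * y) y
  | a2 {x y : O} : Pos x y → Pos (w * x + w * y) (x + w * y)
  | a3 {x y : O} : Pos x y → Pos (w * x + y) (w * x + w * y)
  | a4 {x y : O} : Pos x y → Pos x (w * x + y)

/-- The orbit of the first basis vector under `Γ`, described up to sign and inversion by
`Pos`. -/
def Reduced (a b : O) : Prop := Pos a b ∨ Pos (-a) (-b) ∨ Pos b (-a) ∨ Pos (-b) a

theorem Reduced.neg {a b : O} (h : Reduced a b) : Reduced (-a) (-b) := by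
  rw [Reduced, neg_neg, neg_neg]
  unfold Reduced at h
  tauto

theorem Reduced.inversion {a b : O} (h : Reduced a b) : Reduced (-b) a := by
  rw [Reduced, neg_neg]
  unfold Reduced at h
  tauto

/-- The map is `T S`, which rotates the pentagon: it carries each of the four subdivided sides to
the next and the last one back to the initial side, up to sign and inversion. -/
theorem Pos.reduced_translate_inversion {x y : O} (h : Pos x y) :
    Reduced (-y + w * x) x := by
  cases h with
  | e1 => exact Or.inl (by simpa using Pos.a1 Pos.e2)
  | e2 => exact Or.inr (Or.inl (by simpa using Pos.e1))
  | @a1 x y h =>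
    refine Or.inl ?_
    convert Pos.a2 h using 1
    linear_combination y * w_sq
  | @a2 x y h =>
    refine Or.inl ?_
    convert Pos.a3 h using 1
    linear_combination (x + y) * w_sq
  | @a3 x y h =>
    refine Or.inl ?_
    convert Pos.a4 h using 1
    linear_combination x * w_sq
  | @a4 x y h =>
    refine Or.inr (Or.inr (Or.inl ?_))
    convert h using 1
    ring

theorem Reduced.translate {a b : O} (h : Reduced a b) : Reduced (a + w * b) b := by
  rcases h with h | h | h | h
  · exact Or.inl h.a1
  · refine Or.inr (Or.inl ?_)
    convert h.a1 using 1
    ring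
  · convert h.reduced_translate_inversion using 1
    ring
  · have := h.reduced_translate_inversion.neg
    convert this using 1 <;> ring

/-- The matrix `X` maps reduced vectors to reduced vectors. -/
def Preserves (X : SL) : Prop :=
  ∀ a b, Reduced a b → Reduced (X 0 0 * a + X 0 1 * b) (X 1 0 * a + X 1 1 * b)

theorem Preserves.mul {X Y : SL} (hX : Preserves X) (hY : Preserves Y) : Preserves (X * Y) := by
  intro a b h
  convert hX _ _ (hY a b h) using 1 <;>
  · rw [Matrix.SpecialLinearGroup.coe_mul, mul_apply, mul_apply, Fin.sum_univ_two,
      Fin.sum_univ_two]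
    ring

theorem preserves_S : Preserves S := by
  intro a b h
  simpa [S] using h.inversion

theorem preserves_T : Preserves T := by
  intro a b h
  simpa [T] using h.translate

theorem preserves_of_mem {X : SL} (hX : X ∈ Γ) : Preserves X := by
  suffices Preserves X ∧ Preserves X⁻¹ from this.1
  induction hX using Subgroup.closure_induction with
  | mem x hx =>
    rcases hx with rfl | rfl
    · have : S⁻¹ = S * S * S := by decide
      rw [this]
      exact ⟨preserves_S, (preserves_S.mul preserves_S).mul preserves_S⟩
    · have hTS := preserves_T.mul preserves_S
      -- Inverses come for free from `(T S)⁵ = -1`; the second alternative has the opposite sign,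
      -- since `S * S = -1`.
      have h : T⁻¹ = S * (T * S) * (T * S) * (T * S) * (T * S) ∨
          T⁻¹ = S * S * S * (T * S) * (T * S) * (T * S) * (T * S) := by decide
      refine ⟨preserves_T, ?_⟩
      rcases h with h | h <;> rw [h]
      · exact (((preserves_S.mul hTS).mul hTS).mul hTS).mul hTS
      · exact ((((((preserves_S.mul preserves_S).mul preserves_S).mul hTS).mul hTS).mul hTS)).mul hTS
  | one =>
    have : Preserves 1 := fun a b h => by simpa using h
    simpa using this
  | mul x y _ _ hx hy =>
    rw [_root_.mul_inv_rev]
    exact ⟨hx.1.mul hy.1, hy.2.mul hx.2⟩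
  | inv x _ hx =>
    rw [inv_inv]
    exact hx.symm

theorem reduced_first_col {X : SL} (hX : X ∈ Γ) : Reduced (X 0 0) (X 1 0) := by
  simpa using preserves_of_mem hX 1 0 (Or.inl Pos.e1)

theorem reduced_second_col {X : SL} (hX : X ∈ Γ) : Reduced (X 0 1) (X 1 1) := by
  simpa using preserves_of_mem hX 0 1 (Or.inl Pos.e2)

/-- Elements of `ℤ[λ]` that are zero or at least one. -/
def Big (z : O) : Prop := z = 0 ∨ 1 ≤ emb z

theorem Big.nonneg {z : O} (h : Big z) : 0 ≤ emb z := by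
  rcases h with rfl | h
  · simp
  · linarith

theorem Big.add {x y : O} (hx : Big x) (hy : Big y) : Big (x + y) := by
  rcases hx with rfl | hx
  · simpa using hy
  · right
    rw [map_add]
    linarith [hy.nonneg]

theorem Big.w_mul {x : O} (hx : Big x) : Big (w * x) := by
  rcases hx with rfl | hx
  · left; simp
  · right
    rw [map_mul, emb_w]
    nlinarith [lam_gt]

theorem Big.eq_zero_of_lt_one {x : O} (hx : Big x) (h : emb x < 1) : x = 0 :=
  hx.resolve_right h.not_ge

theorem Pos.big {x y : O} (h : Pos x y) : Big x ∧ Big y := by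
  induction h with
  | e1 => exact ⟨Or.inr (by simp), Or.inl rfl⟩
  | e2 => exact ⟨Or.inl rfl, Or.inr (by simp)⟩
  | a1 _ ih => exact ⟨ih.1.add ih.2.w_mul, ih.2⟩
  | a2 _ ih => exact ⟨ih.1.w_mul.add ih.2.w_mul, ih.1.add ih.2.w_mul⟩
  | a3 _ ih => exact ⟨ih.1.w_mul.add ih.2, ih.1.w_mul.add ih.2.w_mul⟩
  | a4 _ ih => exact ⟨ih.1, ih.1.w_mul.add ih.2⟩

theorem Pos.one_le_or {x y : O} (h : Pos x y) : 1 ≤ emb x ∨ 1 ≤ emb y := by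
  induction h with
  | e1 => left; simp
  | e2 => right; simp
  | @a1 x y h ih =>
    have h1 := h.big.1.nonneg
    have h2 := h.big.2.nonneg
    rcases ih with ih | ih
    · left; simp; nlinarith [lam_gt]
    · right; exact ih
  | @a2 x y h ih =>
    have h1 := h.big.1.nonneg
    have h2 := h.big.2.nonneg
    right
    simp
    rcases ih with ih | ih <;> nlinarith [lam_gt]
  | @a3 x y h ih =>
    have h1 := h.big.1.nonneg
    have h2 := h.big.2.nonneg
    left
    simp
    rcases ih with ih | ih <;> nlinarith [lam_gt]
  | @a4 x y h ih =>
    have h1 := h.big.1.nonneg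
    have h2 := h.big.2.nonneg
    rcases ih with ih | ih
    · left; exact ih
    · right; simp; nlinarith [lam_gt]

/-- Only `a1` can produce `y = 0` and only `a4` can produce `x = 0`, and these steps leave the other
coordinate unchanged. Every other new coordinate is a positive combination of both old ones, hence
nonzero. -/
theorem Pos.axis {x y : O} (h : Pos x y) : (y = 0 → x = 1) ∧ (x = 0 → y = 1) := by
  have key : ∀ {x y : O}, Pos x y → emb x + lam * emb y ≠ 0 ∧ lam * emb x + emb y ≠ 0 := by
    intro x y h
    have h1 := h.big.1.nonneg
    have h2 := h.big.2.nonneg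
    have h3 := lam_gt
    rcases h.one_le_or with h | h <;> constructor <;> apply ne_of_gt <;> nlinarith
  have key' : ∀ {x y : O}, Pos x y → lam * emb x + lam * emb y ≠ 0 := by
    intro x y h
    have h1 := h.big.1.nonneg
    have h2 := h.big.2.nonneg
    have h3 := lam_gt
    rcases h.one_le_or with h | h <;> apply ne_of_gt <;> nlinarith
  induction h with
  | e1 => simp
  | e2 => simp
  | @a1 x y h ih =>
    refine ⟨fun h0 => ?_, fun h0 => absurd (congrArg emb h0) (by simpa using (key h).1)⟩
    simpa [h0] using ih.1 h0
  | @a2 x y h ih =>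
    exact ⟨fun h0 => absurd (congrArg emb h0) (by simpa using (key h).1),
      fun h0 => absurd (congrArg emb h0) (by simpa using key' h)⟩
  | @a3 x y h ih =>
    exact ⟨fun h0 => absurd (congrArg emb h0) (by simpa using key' h),
      fun h0 => absurd (congrArg emb h0) (by simpa using (key h).2)⟩
  | @a4 x y h ih =>
    refine ⟨fun h0 => absurd (congrArg emb h0) (by simpa using (key h).2), fun h0 => ?_⟩
    simpa [h0] using ih.2 h0

/-- The alternatives for the equation `x + λ y = 1` or similar: one of two nonnegative
summands vanishes. -/
theorem Pos.eq_zero_of_add {x y : O} (h : Pos x y) {r : ℝ} :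
    (emb x + lam * emb y = r → r < lam → y = 0) ∧ (lam * emb x + emb y = r → r < lam → x = 0) := by
  have h1 := h.big.1.nonneg
  have h2 := h.big.2.nonneg
  have h3 := lam_gt
  exact ⟨fun e hr => h.big.2.eq_zero_of_lt_one (by nlinarith),
    fun e hr => h.big.1.eq_zero_of_lt_one (by nlinarith)⟩

theorem Pos.ne_one {x y : O} (h : Pos x y) : w * x + w * y ≠ 1 := by
  intro e
  have e' := congrArg emb e
  simp at e'
  have h1 := h.big.1.nonneg
  have h2 := h.big.2.nonneg
  have h3 := lam_gt
  rcases h.one_le_or with h | h <;> nlinarith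

/-- Nonzero coordinates are at least 1 and `λ > 1`, so a coordinate equal to 1 leaves no room for a
term multiplied by `λ`: past the boundary cases only repeated `a1`, or repeated `a4`, occurs. -/
theorem Pos.one {x y : O} (h : Pos x y) :
    (y = 1 → ∃ k : ℕ, x = k * w) ∧ (x = 1 → ∃ k : ℕ, y = k * w) := by
  have h1 : (1 : ℝ) < lam := by linarith [lam_gt]
  induction h with
  | e1 => exact ⟨fun h => absurd h (by decide), fun _ => ⟨0, by simp⟩⟩
  | e2 => exact ⟨fun _ => ⟨0, by simp⟩, fun h => absurd h (by decide)⟩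
  | @a1 x y h ih =>
    refine ⟨fun e => ?_, fun e => ?_⟩
    · obtain ⟨k, hk⟩ := ih.1 e
      exact ⟨k + 1, by rw [hk, e]; push_cast; ring⟩
    · exact ⟨0, by simpa using h.eq_zero_of_add.1 (by simpa using congrArg emb e) h1⟩
  | @a2 x y h ih =>
    refine ⟨fun e => ?_, fun e => absurd e h.ne_one⟩
    have hy := h.eq_zero_of_add.1 (by simpa using congrArg emb e) h1
    exact ⟨1, by simp [hy, h.axis.1 hy]⟩
  | @a3 x y h ih =>
    refine ⟨fun e => absurd e h.ne_one, fun e => ?_⟩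
    have hx := h.eq_zero_of_add.2 (by simpa using congrArg emb e) h1
    exact ⟨1, by simp [hx, h.axis.2 hx]⟩
  | @a4 x y h ih =>
    refine ⟨fun e => ?_, fun e => ?_⟩
    · exact ⟨0, by simpa using h.eq_zero_of_add.2 (by simpa using congrArg emb e) h1⟩
    · obtain ⟨k, hk⟩ := ih.2 e
      exact ⟨k + 1, by rw [hk, e]; push_cast; ring⟩

/-- The same size argument one level up: these are the cusps with denominator `λ`. In
`Reduced.eq_one_of_int` it leaves 1 as the only positive integer numerator. -/
theorem Pos.eq_w {x y : O} (h : Pos x y) (hy : y = w) :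
    ∃ k : ℕ, x = 1 + k * w ^ 2 ∨ x = w + k * w ^ 2 := by
  have hw : w ≠ 1 := by decide
  have h3 := lam_gt
  induction h with
  | e1 => exact absurd hy (by decide)
  | e2 => exact absurd hy (by decide)
  | @a1 x y h ih =>
    obtain ⟨k, hk | hk⟩ := ih hy
    · exact ⟨k + 1, Or.inl (by rw [hk, hy]; push_cast; ring)⟩
    · exact ⟨k + 1, Or.inr (by rw [hk, hy]; push_cast; ring)⟩
  | @a2 x y h ih =>
    have e := congrArg emb hy
    simp at e
    by_cases hy0 : y = 0
    · have := h.axis.1 hy0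
      simp [hy0, this] at e
      linarith
    · have h1 := h.big.2.resolve_left hy0
      have hx := h.big.1.eq_zero_of_lt_one (by nlinarith)
      exact ⟨0, Or.inr (by simp [hx, h.axis.2 hx])⟩
  | @a3 x y h ih =>
    have e := congrArg emb hy
    simp at e
    by_cases hx0 : x = 0
    · exact ⟨0, Or.inl (by simp [hx0, h.axis.2 hx0])⟩
    · have h1 := h.big.1.resolve_left hx0
      have hy := h.big.2.eq_zero_of_lt_one (by nlinarith)
      exact ⟨0, Or.inr (by simp [hy, h.axis.1 hy])⟩
  | @a4 x y h ih =>
    have e := congrArg emb hy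
    simp at e
    by_cases hx0 : x = 0
    · have := h.axis.2 hx0
      simp [hx0, this] at e
      linarith
    · have h1 := h.big.1.resolve_left hx0
      have hy := h.big.2.eq_zero_of_lt_one (by nlinarith)
      exact ⟨0, Or.inl (by simp [h.axis.1 hy])⟩

theorem Reduced.eq_one_or_neg_one {a : O} (h : Reduced a 0) : a = 1 ∨ a = -1 := by
  rcases h with h | h | h | h
  · exact Or.inl (h.axis.1 rfl)
  · exact Or.inr (neg_eq_iff_eq_neg.1 (h.axis.1 neg_zero))
  · exact Or.inr (neg_eq_iff_eq_neg.1 (h.axis.2 rfl))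
  · exact Or.inl (h.axis.2 neg_zero)

theorem Reduced.exists_int_mul {a : O} (h : Reduced a 1) : ∃ k : ℤ, a = k * w := by
  rcases h with h | h | h | h
  · obtain ⟨k, hk⟩ := h.one.1 rfl
    exact ⟨k, by simpa using hk⟩
  · have := h.big.2.nonneg
    simp at this
    linarith
  · obtain ⟨k, hk⟩ := h.one.2 rfl
    exact ⟨-k, by push_cast; linear_combination -hk⟩
  · have := h.big.1.nonneg
    simp at this
    linarith

theorem Reduced.eq_one_of_int {n : ℤ} (hn : 0 < n) (h : Reduced n w) : n = 1 := by
  have hn' : (0 : ℝ) < n := by exact_mod_cast hn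
  have h3 := lam_gt
  rcases h with h | h | h | h
  · obtain ⟨k, hk | hk⟩ := h.eq_w rfl <;> rw [w_sq, w] at hk
    · have h1 := congrArg QuadraticAlgebra.im hk
      have h2 := congrArg QuadraticAlgebra.re hk
      simp [QuadraticAlgebra.re_one, QuadraticAlgebra.im_one] at h1 h2
      omega
    · have h1 := congrArg QuadraticAlgebra.im hk
      simp [QuadraticAlgebra.re_one, QuadraticAlgebra.im_one] at h1
      omega
  all_goals
    have h1 := h.big.1.nonneg
    have h2 := h.big.2.nonneg
    simp at h1 h2
    linarith

/-! ### The stabiliser of infinity and principal ideals -/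

/-- The stabiliser of the cusp at infinity. -/
theorem eq_T_zpow_or_neg {X : SL} (hX : X ∈ Γ) (h : X 1 0 = 0) :
    ∃ k : ℤ, X = T ^ k ∨ X = -T ^ k := by
  have key : ∀ Y : SL, Y ∈ Γ → Y 1 0 = 0 → Y 0 0 = 1 → ∃ k : ℤ, Y = T ^ k := by
    intro Y hY h0 h1
    have hdet := Y.2
    rw [det_fin_two] at hdet
    have h11 : Y 1 1 = 1 := by
      simpa [h0, h1] using hdet
    have := reduced_second_col hY
    rw [h11] at this
    obtain ⟨k, hk⟩ := this.exists_int_mul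
    refine ⟨k, Subtype.ext ?_⟩
    rw [coe_T_zpow]
    refine Matrix.ext fun i j => ?_
    fin_cases i <;> fin_cases j <;> simp [h0, h1, h11, hk]
  have h1 := reduced_first_col hX
  rw [h] at h1
  rcases h1.eq_one_or_neg_one with h1 | h1
  · obtain ⟨k, hk⟩ := key X hX h h1
    exact ⟨k, Or.inl hk⟩
  · obtain ⟨k, hk⟩ := key (-X) (neg_mem hX) (by simp [h]) (by simp [h1])
    exact ⟨k, Or.inr (by rw [← hk, neg_neg])⟩

/-- A pair `(a, b)` is `e` times a column of a matrix of determinant one, so `e` generates the ideal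
`(a, b)`. -/
instance : IsBezout O := by
  rw [IsBezout.iff_span_pair_isPrincipal]
  intro a b
  obtain ⟨X, -, e, ha, hb⟩ := exists_cusp a b
  have hdet := X.2
  rw [det_fin_two] at hdet
  refine ⟨e, le_antisymm ?_ ?_⟩
  · rw [Ideal.span_le]
    rintro x (rfl | rfl)
    · exact Ideal.mem_span_singleton.2 ⟨X 0 0, by rw [ha]; ring⟩
    · exact Ideal.mem_span_singleton.2 ⟨X 1 0, by rw [hb]; ring⟩
  · refine (Ideal.span_singleton_le_iff_mem _).2 (Ideal.mem_span_pair.2 ⟨X 1 1, -X 0 1, ?_⟩)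
    rw [ha, hb]
    linear_combination e * hdet

instance : IsNoetherianRing O := IsNoetherianRing.of_finite ℤ O

/-- In a principal ideal domain a unimodular triple can be shortened to a coprime pair. -/
theorem exists_isCoprime_add_mul {R : Type*} [CommRing R] [IsDomain R] [IsPrincipalIdealRing R]
    {a : R} (b c : R) (ha : a ≠ 0) (h : ∃ x y z, x * a + y * b + z * c = 1) :
    ∃ s, IsCoprime a (b + c * s) := by
  induction a using UniqueFactorizationMonoid.induction_on_prime with
  | h₁ => exact absurd rfl ha
  | h₂ a hu =>
    obtain ⟨u, rfl⟩ := hu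
    exact ⟨0, ↑u⁻¹, 0, by simp⟩
  | h₃ a p ha' hp ih =>
    obtain ⟨x, y, z, e⟩ := h
    obtain ⟨s, hs⟩ := ih ha' ⟨x * p, y, z, by linear_combination e⟩
    by_cases hdvd : p ∣ b + c * s
    -- Replacing `s` by `s + a` changes the value by `ca`: this keeps it coprime to `a`, and `p`
    -- divides neither `c` (unimodularity) nor `a`.
    · refine ⟨s + a, IsCoprime.mul_left ?_ ?_⟩
      · refine (hp.irreducible.coprime_iff_not_dvd).2 fun h1 => ?_
        have h2 : p ∣ c * a := by
          have := dvd_sub h1 hdvd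
          rwa [show b + c * (s + a) - (b + c * s) = c * a by ring] at this
        rcases hp.dvd_or_dvd h2 with hc | ha
        · have hb : p ∣ b := (dvd_add_left (hc.mul_right s)).1 hdvd
          refine hp.not_isUnit (isUnit_of_dvd_one ?_)
          rw [← e]
          exact dvd_add (dvd_add ((dvd_mul_right p a).mul_left x) (hb.mul_left y)) (hc.mul_left z)
        · exact hp.not_isUnit (hs.isUnit_of_dvd' ha hdvd)
      · have : b + c * (s + a) = b + c * s + a * c := by ring
        rw [this]
        exact hs.add_mul_left_right c
    · exact ⟨s, IsCoprime.mul_left ((hp.irreducible.coprime_iff_not_dvd).2 hdvd) hs⟩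

section Entries

variable {R : Type*} [CommRing R] (X Y : Matrix.SpecialLinearGroup (Fin 2) R)

theorem mul_entry (i j : Fin 2) : (X * Y) i j = X i 0 * Y 0 j + X i 1 * Y 1 j := by
  rw [Matrix.SpecialLinearGroup.coe_mul, mul_apply, Fin.sum_univ_two]

theorem inv_entries :
    X⁻¹ 0 0 = X 1 1 ∧ X⁻¹ 0 1 = -X 0 1 ∧ X⁻¹ 1 0 = -X 1 0 ∧ X⁻¹ 1 1 = X 0 0 := by
  rw [Matrix.SpecialLinearGroup.SL2_inv_expl]
  simp

theorem det_entries : X 0 0 * X 1 1 - X 0 1 * X 1 0 = 1 := by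
  rw [← det_fin_two]
  exact X.2

end Entries

/-- In a principal ideal domain a triple can be divided by its greatest common divisor. -/
theorem exists_eq_mul_unimodular {R : Type*} [CommRing R] [IsDomain R] [IsPrincipalIdealRing R]
    {a : R} (b c : R) (ha : a ≠ 0) :
    ∃ g a₀ b₀ c₀ : R, g ≠ 0 ∧ a = g * a₀ ∧ b = g * b₀ ∧ c = g * c₀ ∧
      ∃ x y z, x * a₀ + y * b₀ + z * c₀ = 1 := by
  obtain ⟨g, hg⟩ := (IsPrincipalIdealRing.principal (Ideal.span {a, b, c})).principal
  have hdvd : ∀ x ∈ ({a, b, c} : Set R), g ∣ x := by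
    intro x hx
    have := Ideal.subset_span hx
    rw [hg] at this
    exact Ideal.mem_span_singleton.1 this
  obtain ⟨a₀, rfl⟩ := hdvd a (by simp)
  obtain ⟨b₀, rfl⟩ := hdvd b (by simp)
  obtain ⟨c₀, rfl⟩ := hdvd c (by simp)
  have hg0 : g ≠ 0 := left_ne_zero_of_mul ha
  have hmem : g ∈ Submodule.span R {g * a₀, g * b₀, g * c₀} := by
    rw [show Submodule.span R {g * a₀, g * b₀, g * c₀} = _ from hg]
    exact Submodule.mem_span_singleton_self g
  obtain ⟨x, y, z, e⟩ := Submodule.mem_span_triple.1 hmem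
  refine ⟨g, a₀, b₀, c₀, hg0, rfl, rfl, rfl, x, y, z, mul_left_cancel₀ hg0 ?_⟩
  simp only [smul_eq_mul] at e
  linear_combination e

/-! ### Real matrices conjugating parabolic elements into `Γ` -/

/-- `SL₂(ℝ)`. -/
abbrev SLR : Type := Matrix.SpecialLinearGroup (Fin 2) ℝ

/-- The inclusion of `SL₂(ℤ[λ])` in `SL₂(ℝ)`. -/
noncomputable def incl : SL →* SLR := Matrix.SpecialLinearGroup.map emb

theorem incl_apply (X : SL) (i j : Fin 2) : incl X i j = emb (X i j) := rfl

theorem mul_incl_entry (A : SLR) (X : SL) (i j : Fin 2) :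
    (A * incl X) i j = A i 0 * emb (X 0 j) + A i 1 * emb (X 1 j) := by
  rw [mul_entry]
  rfl

theorem mul_incl_S_entries (A : SLR) :
    (A * incl S) 0 0 = A 0 1 ∧ (A * incl S) 1 0 = A 1 1 := by
  rw [mul_incl_entry, mul_incl_entry]
  simp [S]

theorem incl_neg (X : SL) : incl (-X) = -incl X := by
  refine Matrix.SpecialLinearGroup.ext _ _ fun i j => ?_
  simp [incl_apply]

theorem incl_injective : Function.Injective incl := by
  intro X Y h
  refine Matrix.SpecialLinearGroup.ext _ _ fun i j => emb_injective ?_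
  rw [← incl_apply, ← incl_apply, h]

/-- The conjugates by `A` of the `N`-th powers of the parabolic elements of `Γ` belong to `Γ`. -/
def ConjugatesPowers (N : ℕ) (A : SLR) : Prop :=
  ∀ X ∈ Γ, A * incl (X * T ^ N * X⁻¹) * A⁻¹ ∈ Γ.map incl

theorem ConjugatesPowers.mul_mul {N : ℕ} {A : SLR} (hA : ConjugatesPowers N A) {X Y : SL}
    (hX : X ∈ Γ) (hY : Y ∈ Γ) : ConjugatesPowers N ((incl Y)⁻¹ * A * incl X) := by
  intro Z hZ
  have h := hA (X * Z) (mul_mem hX hZ)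
  have hY' : incl Y ∈ Γ.map incl := Subgroup.mem_map_of_mem _ hY
  have := mul_mem (mul_mem (inv_mem hY') h) hY'
  convert this using 1
  simp only [map_mul, map_inv]
  group

variable {N : ℕ} {A : SLR}

/-- The entries of `A T^N A⁻¹`. They put `Nλ` times the quadratic monomials in the first column of
`A` into `ℤ[λ]`, the source of all arithmetic information on `A`. -/
theorem ConjugatesPowers.exists_parabolic (hA : ConjugatesPowers N A) :
    ∃ Z ∈ Γ, emb (Z 0 0) = 1 - N * lam * A 0 0 * A 1 0 ∧ emb (Z 0 1) = N * lam * A 0 0 ^ 2 ∧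
      emb (Z 1 0) = -(N * lam * A 1 0 ^ 2) := by
  obtain ⟨Z, hZ, h⟩ := hA 1 (one_mem _)
  have hT : ((T ^ N : SL) : Mat) = !![1, N * w; 0, 1] := by
    simpa using coe_T_zpow N
  have hT' : ∀ i j, incl (T ^ N) i j = emb ((!![1, N * w; 0, 1] : Mat) i j) := by
    intro i j
    rw [incl_apply, hT]
  have hdet := det_entries A
  obtain ⟨h00, h01, h10, h11⟩ := inv_entries A
  have hZ' : incl Z = A * incl (T ^ N) * A⁻¹ := by
    rw [h]
    simp
  have hij : ∀ i j, emb (Z i j) = (A * incl (T ^ N) * A⁻¹) i j := by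
    intro i j
    rw [← incl_apply, hZ']
  refine ⟨Z, hZ, ?_, ?_, ?_⟩
  · rw [hij]
    simp only [mul_entry, hT', h00, h10]
    simp
    linear_combination hdet
  · rw [hij]
    simp only [mul_entry, hT', h01, h11]
    simp
    ring
  · rw [hij]
    simp only [mul_entry, hT', h00, h10]
    simp
    ring

/-- The diagonal entries of a triangular matrix conjugating parabolic elements are determined by
an integer. -/
theorem ConjugatesPowers.exists_int (hA : ConjugatesPowers N A) (h : A 1 0 = 0) :
    ∃ m : ℤ, (N : ℝ) * A 0 0 ^ 2 = m := by
  obtain ⟨Z, hZ, h0, h1, h2⟩ := hA.exists_parabolic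
  rw [h] at h0 h2
  have hZ0 : Z 1 0 = 0 := by
    rw [← emb_eq_zero, h2]
    simp
  have hZ1 : Z 0 0 = 1 := emb_injective (by simpa using h0)
  obtain ⟨k, hk | hk⟩ := eq_T_zpow_or_neg hZ hZ0
  · refine ⟨k, ?_⟩
    have : Z 0 1 = k * w := by
      rw [hk, coe_T_zpow]
      simp
    rw [this] at h1
    simp at h1
    have hl := lam_pos.ne'
    apply mul_right_cancel₀ hl
    linear_combination -h1
  · have : Z 0 0 = -1 := by
      rw [hk, Matrix.SpecialLinearGroup.coe_neg, Matrix.neg_apply, coe_T_zpow]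
      simp
    exact absurd (hZ1.symm.trans this) (by decide)

/-- If `A X` and `Y` have proportional first columns then `Y⁻¹ A X` is triangular. -/
theorem triangular_of_col {X Y : SL} {t : ℝ}
    (h0 : (A * incl X) 0 0 = t * emb (Y 0 0)) (h1 : (A * incl X) 1 0 = t * emb (Y 1 0)) :
    ((incl Y)⁻¹ * A * incl X) 0 0 = t ∧ ((incl Y)⁻¹ * A * incl X) 1 0 = 0 := by
  obtain ⟨h00, h01, h10, h11⟩ := inv_entries (incl Y)
  have hdet := congrArg emb (det_entries Y)
  simp at hdet
  rw [mul_assoc, mul_entry (incl Y)⁻¹, mul_entry (incl Y)⁻¹, h0, h1, h00, h01, h10, h11]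
  simp only [incl_apply]
  constructor
  · linear_combination t * hdet
  · ring

/-- The point `A ∞` is fixed by a parabolic element of `Γ`, so it is read off from entries in
`ℤ[λ]`; being in `ℙ¹(ℚ(λ))`, it is a cusp and can be moved to infinity. -/
theorem ConjugatesPowers.exists_triangular (hA : ConjugatesPowers N A) (hN : N ≠ 0) :
    ∃ Y ∈ Γ, ((incl Y)⁻¹ * A) 1 0 = 0 := by
  have hN' : (N : ℝ) ≠ 0 := by exact_mod_cast hN
  have hl := lam_pos.ne'
  by_cases hq : A 1 0 = 0
  · exact ⟨1, one_mem _, by simpa using hq⟩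
  obtain ⟨Z, hZ, h0, h1, h2⟩ := hA.exists_parabolic
  obtain ⟨Y, hY, e, ha, hb⟩ := exists_cusp (1 - Z 0 0) (-Z 1 0)
  have ha' := congrArg emb ha
  have hb' := congrArg emb hb
  simp [h0, h2] at ha' hb'
  have hb0 : emb (Y 1 0) * emb e ≠ 0 := by
    rw [← hb']
    positivity
  have hY0 : emb (Y 1 0) ≠ 0 := left_ne_zero_of_mul hb0
  have he0 : emb e ≠ 0 := right_ne_zero_of_mul hb0
  have key : A 0 0 * emb (Y 1 0) = A 1 0 * emb (Y 0 0) := by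
    apply mul_right_cancel₀ he0
    apply mul_right_cancel₀ hq
    linear_combination (-A 0 0 * A 1 0) * hb' + A 1 0 ^ 2 * ha'
  refine ⟨Y, hY, ?_⟩
  have := (triangular_of_col (A := A) (X := 1) (Y := Y) (t := A 1 0 / emb (Y 1 0)) ?_ ?_).2
  · simpa using this
  · simp only [map_one, mul_one]
    field_simp
    exact key
  · simp only [map_one, mul_one]
    field_simp

/-- A triangular matrix conjugating parabolic elements can be moved by `Γ` on both sides to act
as `z ↦ n z + b` with `n` a positive integer and `b ∈ ℤ[λ]`. -/
theorem ConjugatesPowers.exists_integral (hA : ConjugatesPowers N A) (hN : N ≠ 0)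
    (h : A 1 0 = 0) :
    ∃ X ∈ Γ, ∃ Y ∈ Γ, ∃ n : ℤ, ∃ b : O, ((incl Y)⁻¹ * A * incl X) 1 0 = 0 ∧
      ((incl Y)⁻¹ * A * incl X) 0 0 ^ 2 = n ∧
      ((incl Y)⁻¹ * A * incl X) 0 0 * ((incl Y)⁻¹ * A * incl X) 0 1 = emb b := by
  have hN' : (N : ℝ) ≠ 0 := by exact_mod_cast hN
  have hl := lam_pos.ne'
  have hdet := det_entries A
  rw [h, mul_zero, sub_zero] at hdet
  -- the columns of `A` are proportional to vectors over `ℤ[λ]`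
  obtain ⟨Z, hZ, hp0, hp1, hp2⟩ :=
    (hA.mul_mul S_mem (one_mem Γ)).exists_parabolic
  obtain ⟨hc0, hc1⟩ := mul_incl_S_entries A
  rw [map_one, inv_one, one_mul] at hp0 hp2
  rw [hc0, hc1] at hp0
  rw [hc1] at hp2
  -- The matrix with rows `(a, b)` and `(0, c)` is `A` scaled by `N * A 1 1`. The factor `w - 1` is
  -- `1/λ` and cancels the `λ` coming from `T`.
  obtain ⟨a, ha⟩ : ∃ a : O, a = N := ⟨_, rfl⟩
  obtain ⟨b, hb⟩ : ∃ b : O, b = (w - 1) * (1 - Z 0 0) := ⟨_, rfl⟩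
  obtain ⟨c, hc⟩ : ∃ c : O, c = (w - 1) * -Z 1 0 := ⟨_, rfl⟩
  have ea : emb a = N := by simp [ha]
  have hlam : (lam - 1) * lam = 1 := by linear_combination lam_sq
  have eb : emb b = N * (A 0 1 * A 1 1) := by
    simp [hb, hp0]
    linear_combination (N * A 0 1 * A 1 1) * hlam
  have ec : emb c = N * A 1 1 ^ 2 := by
    simp [hc, hp2]
    linear_combination (N * A 1 1 ^ 2) * hlam
  -- divide by the greatest common divisor
  obtain ⟨g, a, b, c, hg, rfl, rfl, rfl, hbez⟩ : ∃ g a₀ b₀ c₀ : O, g ≠ 0 ∧ a = g * a₀ ∧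
      b = g * b₀ ∧ c = g * c₀ ∧ ∃ x y z, x * a₀ + y * b₀ + z * c₀ = 1 :=
    exists_eq_mul_unimodular b c (by
      rintro rfl
      simp at ea
      exact hN' ea.symm)
  have hg' := emb_eq_zero.not.2 hg
  have hga : emb g * emb a = N := by rw [← ea, map_mul]
  have eb' : emb b = emb a * (A 0 1 * A 1 1) := by
    apply mul_left_cancel₀ hg'
    rw [← map_mul, eb, ← hga]
    ring
  have ec' : emb c = emb a * A 1 1 ^ 2 := by
    apply mul_left_cancel₀ hg'
    rw [← map_mul, ec, ← hga]
    ring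
  have ha0 : a ≠ 0 := by
    rintro rfl
    simp at hga
    exact hN' hga.symm
  -- Smith normal form by elements of `Γ`: the integral matrix sends the coprime column `(-b + cs,
  -- a)` to `ac (s, 1)`. With `X` and `Y` built on these two columns, the scaled product is
  -- triangular with a unit in the lower right corner.
  obtain ⟨s, hs⟩ := exists_isCoprime_add_mul (-b) c ha0 (by
    obtain ⟨x, y, z, e⟩ := hbez
    exact ⟨x, -y, z, by linear_combination e⟩)
  obtain ⟨X, hX, e, hX0, hX1⟩ := exists_cusp (-b + c * s) a
  obtain ⟨Y, hY, f, hY0, hY1⟩ := exists_cusp s 1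
  have he : IsUnit e := by
    refine hs.isUnit_of_dvd' ⟨X 1 0, ?_⟩ ⟨X 0 0, ?_⟩
    · rw [hX1]; ring
    · rw [hX0]; ring
  obtain ⟨u, rfl⟩ := he
  have hu : emb u * emb (↑u⁻¹ : O) = 1 := by
    rw [← map_mul]; simp
  have hu0 : emb u ≠ 0 := left_ne_zero_of_mul_eq_one hu
  have hX0' := congrArg emb hX0
  have hX1' := congrArg emb hX1
  have hY0' := congrArg emb hY0
  have hY1' := congrArg emb hY1
  simp only [map_add, map_neg, map_mul, map_one] at hX0' hX1' hY0' hY1'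
  obtain ⟨t, ht⟩ : ∃ t : ℝ, t = A 1 1 * emb a * emb f * emb (↑u⁻¹ : O) := ⟨_, rfl⟩
  obtain ⟨h00, h10⟩ := triangular_of_col (A := A) (X := X) (Y := Y) (t := t) (by
      rw [mul_incl_entry]
      apply mul_right_cancel₀ hu0
      linear_combination (-A 0 0) * hX0' - A 0 1 * hX1' - A 0 0 * eb' + A 0 0 * emb s * ec' -
        (emb a * A 0 1 - emb a * A 1 1 * emb s) * hdet - (emb (Y 0 0) * emb u) * ht -
        emb (Y 0 0) * A 1 1 * emb a * emb f * hu + (A 1 1 * emb a) * hY0') (by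
      rw [mul_incl_entry, h]
      apply mul_right_cancel₀ hu0
      linear_combination (-A 1 1) * hX1' - (emb (Y 1 0) * emb u) * ht -
        emb (Y 1 0) * A 1 1 * emb a * emb f * hu + (A 1 1 * emb a) * hY1')
  have hsq : emb (c * a * (f * ↑u⁻¹) ^ 2) = t ^ 2 := by
    simp only [map_mul, map_pow]
    rw [ec', ht]
    ring
  obtain ⟨m, hm⟩ := (hA.mul_mul hX hY).exists_int h10
  rw [h00, ← hsq] at hm
  obtain ⟨n, hn⟩ := exists_int_of_emb_eq_rat (q := (m : ℚ) / N) (by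
    push_cast
    rw [eq_div_iff hN', ← hm]
    ring)
  refine ⟨X, hX, Y, hY, n, f * ↑u⁻¹ * (Y 1 1 * (a * X 0 1 + b * X 1 1) - Y 0 1 * (c * X 1 1)),
    h10, ?_, ?_⟩
  · rw [h00, ← hsq, hn]
    simp
  · obtain ⟨i00, i01, -, -⟩ := inv_entries (incl Y)
    rw [h00, mul_assoc, mul_entry (incl Y)⁻¹, mul_incl_entry, mul_incl_entry, i00, i01, h]
    simp only [map_mul, map_add, map_sub, incl_apply]
    rw [ht, eb', ec']
    linear_combination (emb a * emb f * emb (↑u⁻¹ : O) * emb (Y 1 1) * emb (X 0 1)) * hdet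

/-- A coprime pair is a first column of `Γ` only up to a unit `u`. Here the triangular matrix has
diagonal entry `u/t`, so `N u²/t²` is an integer; thus `u²` is a rational unit and positive, and `u
= ±1`. -/
theorem ConjugatesPowers.reduced_of_col (hA : ConjugatesPowers N A) (hN : N ≠ 0) {t : ℝ} {n : ℤ}
    (ht : t ≠ 0) (hn : t ^ 2 = n) {X : SL} (hX : X ∈ Γ) {a b : O} (hab : IsCoprime a b)
    (h0 : t * (A * incl X) 0 0 = emb a) (h1 : t * (A * incl X) 1 0 = emb b) : Reduced a b := by
  have hN' : (N : ℝ) ≠ 0 := by exact_mod_cast hN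
  obtain ⟨Y, hY, e, ha, hb⟩ := exists_cusp a b
  have he : IsUnit e := by
    refine hab.isUnit_of_dvd' ⟨Y 0 0, ?_⟩ ⟨Y 1 0, ?_⟩
    · rw [ha]; ring
    · rw [hb]; ring
  obtain ⟨u, rfl⟩ := he
  obtain ⟨h00, h10⟩ := triangular_of_col (A := A) (X := X) (Y := Y) (t := emb u / t) (by
      rw [ha, map_mul] at h0
      field_simp
      linear_combination h0) (by
      rw [hb, map_mul] at h1
      field_simp
      linear_combination h1)
  obtain ⟨m, hm⟩ := (hA.mul_mul hX hY).exists_int h10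
  rw [h00] at hm
  have hn0 : (n : ℝ) ≠ 0 := by
    rw [← hn]
    positivity
  have hu2 : emb (↑u ^ 2) = ((m * n / N : ℚ) : ℝ) := by
    push_cast
    rw [← hm, ← hn, map_pow]
    field_simp
  have huu : emb (↑u ^ 2) * emb (↑u⁻¹ ^ 2) = 1 := by
    rw [← map_mul, ← mul_pow]
    simp
  obtain ⟨j, hj⟩ := exists_int_of_emb_eq_rat hu2
  have hui : emb (↑u⁻¹ ^ 2) = (((m * n / N)⁻¹ : ℚ) : ℝ) := by
    rw [Rat.cast_inv, ← hu2]
    exact eq_inv_of_mul_eq_one_right huu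
  obtain ⟨i, hi⟩ := exists_int_of_emb_eq_rat hui
  rw [hj, hi] at huu
  have hji : j * i = 1 := by
    simp at huu
    exact_mod_cast huu
  have hj0 : (0 : ℝ) ≤ j := by
    have : emb (↑u ^ 2) = j := by rw [hj]; simp
    rw [← this, map_pow]
    positivity
  have hj1 : j = 1 := by
    rcases Int.eq_one_or_neg_one_of_mul_eq_one hji with h | h
    · exact h
    · rw [h] at hj0
      norm_num at hj0
  have hred := reduced_first_col hY
  rw [hj1, Int.cast_one, sq, mul_self_eq_one_iff] at hj
  rcases hj with hj | hj
  · simpa [ha, hb, hj] using hred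
  · simpa [ha, hb, hj] using hred.neg

/-- A triangular matrix that acts as `z ↦ n z + b` and conjugates parabolic elements of `Γ` into
`Γ` is an element of `Γ`. -/
theorem ConjugatesPowers.mem_of_integral (hA : ConjugatesPowers N A) (hN : N ≠ 0) {n : ℤ} {b : O}
    (h : A 1 0 = 0) (hn : A 0 0 ^ 2 = n) (hb : A 0 0 * A 0 1 = emb b) : A ∈ Γ.map incl := by
  have hdet := det_entries A
  rw [h, mul_zero, sub_zero] at hdet
  have ht : A 0 0 ≠ 0 := left_ne_zero_of_mul_eq_one hdet
  have hn0 : 0 < n := by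
    have : (0 : ℝ) < n := by
      rw [← hn]
      positivity
    exact_mod_cast this
  have hb1 : Reduced b 1 := by
    refine hA.reduced_of_col hN ht hn S_mem isCoprime_one_right ?_ ?_
    · rw [(mul_incl_S_entries A).1, hb]
    · rw [(mul_incl_S_entries A).2, hdet, map_one]
  obtain ⟨k, rfl⟩ := hb1.exists_int_mul
  have hw : w * (w - 1) = 1 := by decide
  have hnw : Reduced (n + k * w * w) w := by
    refine hA.reduced_of_col hN ht hn U_mem ⟨0, w - 1, ?_⟩ ?_ ?_
    · linear_combination hw
    · rw [mul_incl_entry]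
      simp [U]
      simp at hb
      linear_combination hn + lam * hb
    · rw [mul_incl_entry, h]
      simp [U]
      linear_combination lam * hdet
  have hn1 : n = 1 := by
    refine Reduced.eq_one_of_int hn0 ?_
    have := preserves_of_mem (zpow_mem T_mem (-k)) _ _ hnw
    rw [coe_T_zpow] at this
    simpa using this
  have hT : T ^ k ∈ Γ := zpow_mem T_mem k
  have hTk : ∀ i j, incl (T ^ k) i j = emb ((!![1, k * w; 0, 1] : Mat) i j) := by
    intro i j
    rw [incl_apply, coe_T_zpow]
  rw [hn1, Int.cast_one, sq, mul_self_eq_one_iff] at hn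
  rcases hn with hn | hn
  · refine ⟨T ^ k, hT, Matrix.SpecialLinearGroup.ext _ _ fun i j => ?_⟩
    rw [hTk]
    rw [hn, one_mul] at hb hdet
    fin_cases i <;> fin_cases j <;> simp [h, hn, hb, hdet]
  · refine ⟨-T ^ k, neg_mem hT, Matrix.SpecialLinearGroup.ext _ _ fun i j => ?_⟩
    rw [incl_neg, Matrix.SpecialLinearGroup.coe_neg, Matrix.neg_apply, hTk]
    rw [hn, neg_one_mul] at hb hdet
    have h01 : A 0 1 = -emb (k * w) := by linarith
    have h11 : A 1 1 = -1 := by linarith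
    fin_cases i <;> fin_cases j <;> simp [h, hn, h01, h11]

/-- The matrices that conjugate the `N`-th powers of all parabolic elements of `Γ` into `Γ` belong
to `Γ`: this is the part of the maximality of the nonarithmetic group `G₅` in its commensurator
that the normaliser needs. -/
theorem ConjugatesPowers.mem (hA : ConjugatesPowers N A) (hN : N ≠ 0) : A ∈ Γ.map incl := by
  obtain ⟨Y, hY, h⟩ := hA.exists_triangular hN
  have hB : ConjugatesPowers N ((incl Y)⁻¹ * A) := by
    simpa using hA.mul_mul (one_mem Γ) hY
  obtain ⟨X, hX, Z, hZ, n, b, h1, h2, h3⟩ := hB.exists_integral hN h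
  have hC := (hB.mul_mul hX hZ).mem_of_integral hN h1 h2 h3
  have hY' : incl Y ∈ Γ.map incl := Subgroup.mem_map_of_mem _ hY
  have hZ' : incl Z ∈ Γ.map incl := Subgroup.mem_map_of_mem _ hZ
  have hX' : incl X ∈ Γ.map incl := Subgroup.mem_map_of_mem _ hX
  rwa [Subgroup.mul_mem_cancel_right _ hX', Subgroup.mul_mem_cancel_left _ (inv_mem hZ'),
    Subgroup.mul_mem_cancel_left _ (inv_mem hY')] at hC

/-! ### Divisibility conditions on the lower left entry -/

/-- This and the next two elements feed `Normalizes.dvd_of_first_col`: the column `(-m λ^i,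
λ^(i+1))` can be changed by a power of `U` so that its lower entry becomes divisible by a given
integer prime to `m`. -/
theorem exists_first_col_two : ∃ V ∈ Γ, V 0 0 = -(2 * w ^ 2) ∧ V 1 0 = w ^ 3 := by
  refine ⟨-(S * T * S * T * T * S * T)⁻¹, neg_mem (inv_mem ?_), by decide, by decide⟩
  exact mul_mem (mul_mem (mul_mem (mul_mem (mul_mem (mul_mem S_mem T_mem) S_mem) T_mem) T_mem)
    S_mem) T_mem

theorem exists_first_col_four : ∃ V ∈ Γ, V 0 0 = -(4 * w ^ 2) ∧ V 1 0 = w ^ 3 := by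
  refine ⟨-(S * T * T * S * T * S * T * T)⁻¹, neg_mem (inv_mem ?_), by decide, by decide⟩
  exact mul_mem (mul_mem (mul_mem (mul_mem (mul_mem (mul_mem (mul_mem S_mem T_mem) T_mem) S_mem)
    T_mem) S_mem) T_mem) T_mem

theorem exists_first_col_three : ∃ V ∈ Γ, V 0 0 = -(3 * w ^ 3) ∧ V 1 0 = w ^ 4 := by
  refine ⟨(S * T * S * T * S * T⁻¹ * T⁻¹ * S * T)⁻¹, inv_mem ?_, by decide, by decide⟩
  have hT' := inv_mem T_mem
  exact mul_mem (mul_mem (mul_mem (mul_mem (mul_mem (mul_mem (mul_mem (mul_mem S_mem T_mem) S_mem)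
    T_mem) S_mem) hT') hT') S_mem) T_mem

/-- Reduction of matrices modulo an integer. -/
noncomputable def red (n : ℤ) : SL →* Matrix.SpecialLinearGroup (Fin 2) (O ⧸ Ideal.span {(n : O)}) :=
  Matrix.SpecialLinearGroup.map (Ideal.Quotient.mk _)

theorem red_eq_iff {n : ℤ} {X Y : SL} : red n X = red n Y ↔ ∀ i j, (n : O) ∣ X i j - Y i j := by
  rw [Matrix.SpecialLinearGroup.ext_iff]
  refine forall_congr' fun i => forall_congr' fun j => ?_
  rw [← Ideal.mem_span_singleton, ← Ideal.Quotient.mk_eq_mk_iff_sub_mem]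
  rfl

/-- An element of `Γ` can be prescribed modulo `m` and trivial modulo a coprime `n`. -/
theorem exists_red_eq {m n : ℤ} (hmn : IsCoprime m n) {X : SL} (hX : X ∈ Γ) :
    ∃ Y ∈ Γ, red m Y = red m X ∧ red n Y = 1 := by
  obtain ⟨u, v, huv⟩ := hmn
  have hX' := mem_closure_T_U hX
  have h1 : (m : O) ∣ ((v * n : ℤ) : O) * w - w := by
    refine ⟨-u * w, ?_⟩
    have := congrArg (Int.cast : ℤ → O) huv
    push_cast at this ⊢
    linear_combination w * this
  have h2 : (n : O) ∣ ((v * n : ℤ) : O) * w := by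
    refine ⟨v * w, ?_⟩
    push_cast
    ring
  clear hX
  induction hX' using Subgroup.closure_induction with
  | mem x hx =>
    rcases hx with rfl | rfl
    -- The exponent `v * n` is 1 modulo `m` and 0 modulo `n`.
    · refine ⟨T ^ (v * n), zpow_mem T_mem _, red_eq_iff.2 fun i j => ?_, ?_⟩
      · rw [coe_T_zpow]
        fin_cases i <;> fin_cases j <;> simp [T]
        simpa using h1
      · rw [← map_one (red n)]
        refine red_eq_iff.2 fun i j => ?_
        rw [coe_T_zpow]
        fin_cases i <;> fin_cases j <;> simp
        simpa using h2
    · refine ⟨U ^ (v * n), zpow_mem U_mem _, red_eq_iff.2 fun i j => ?_, ?_⟩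
      · rw [coe_U_zpow]
        fin_cases i <;> fin_cases j <;> simp [U]
        simpa using h1
      · rw [← map_one (red n)]
        refine red_eq_iff.2 fun i j => ?_
        rw [coe_U_zpow]
        fin_cases i <;> fin_cases j <;> simp
        simpa using h2
  | one => exact ⟨1, one_mem _, rfl, map_one _⟩
  | mul x y _ _ hx hy =>
    obtain ⟨x', hx', ex, ex'⟩ := hx
    obtain ⟨y', hy', ey, ey'⟩ := hy
    exact ⟨x' * y', mul_mem hx' hy', by rw [map_mul, map_mul, ex, ey],
      by rw [map_mul, ex', ey', one_mul]⟩
  | inv x _ hx =>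
    obtain ⟨x', hx', ex, ex'⟩ := hx
    exact ⟨x'⁻¹, inv_mem hx', by rw [map_inv, map_inv, ex], by rw [map_inv, ex', inv_one]⟩

/-- Conjugation by `B` preserves divisibility by `t` of the lower left entries of elements
of `Γ`. -/
def Normalizes (t : O) (B : SL) : Prop :=
  ∀ C ∈ Γ, t ∣ C 1 0 → t ∣ (B * C * B⁻¹) 1 0

theorem conj_entry (B C : SL) : (B * C * B⁻¹) 1 0 =
    B 1 0 * B 1 1 * (C 0 0 - C 1 1) + B 1 1 ^ 2 * C 1 0 - B 1 0 ^ 2 * C 0 1 := by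
  obtain ⟨h00, -, h10, -⟩ := inv_entries B
  rw [mul_entry, mul_entry, mul_entry, h00, h10]
  ring

variable {t : O} {B : SL}

theorem Normalizes.dvd_sq (hB : Normalizes t B) : t ∣ B 1 0 ^ 2 := by
  have h := hB T T_mem (by simp [T])
  rw [conj_entry] at h
  have hw : (w - 1) * w = 1 := by decide
  have e : B 1 0 ^ 2 = (1 - w) * (B 1 0 * B 1 1 * (T 0 0 - T 1 1) + B 1 1 ^ 2 * T 1 0 -
      B 1 0 ^ 2 * T 0 1) := by
    simp [T]
    linear_combination (-B 1 0 ^ 2) * hw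
  rw [e]
  exact h.mul_left _

/-- Modulo `t` the squares of `B 1 0` vanish, so conjugation leaves `B 1 0 * B 1 1 * (C 0 0 - C 1
1)`. The factor `B 1 1` is removed with `B 0 0`, and `C 0 0 * C 1 1` is 1 modulo `t`. -/
theorem Normalizes.dvd_mul_sq_sub_one (hB : Normalizes t B) {C : SL} (hC : C ∈ Γ)
    (ht : t ∣ C 1 0) : t ∣ B 1 0 * (C 0 0 ^ 2 - 1) := by
  have h := hB C hC ht
  have hc := hB.dvd_sq
  have hB1 := det_entries B
  have hC1 := det_entries C
  rw [conj_entry] at h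
  obtain ⟨x, hx⟩ := h
  obtain ⟨y, hy⟩ := hc
  obtain ⟨z, hz⟩ := ht
  have h1 : t ∣ B 1 0 * (C 0 0 - C 1 1) := by
    refine ⟨B 0 0 * (x - B 1 1 ^ 2 * z + y * C 0 1) - B 0 1 * y * (C 0 0 - C 1 1), ?_⟩
    linear_combination (-B 1 0 * (C 0 0 - C 1 1)) * hB1 + B 0 0 * hx - B 0 0 * B 1 1 ^ 2 * hz +
      (B 0 0 * C 0 1 - B 0 1 * (C 0 0 - C 1 1)) * hy
  obtain ⟨v, hv⟩ := h1
  refine ⟨C 0 0 * v + B 1 0 * C 0 1 * z, ?_⟩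
  linear_combination C 0 0 * hv + B 1 0 * hC1 + B 1 0 * C 0 1 * hz

/-- Take `C` congruent to `U ^ r * V` modulo `M` and to 1 modulo `M'`, where `r m` is 1 modulo `M`.
Then `C 1 0` is divisible by `M M'`, while `C 0 0` is `-m λ^i` modulo `M`; the factor `M'` makes up
for the other modulus. -/
theorem Normalizes.dvd_of_first_col (hB : Normalizes t B) {M M' m : ℤ} {i : ℕ}
    (ht : t ∣ ((M * M' : ℤ) : O)) (hM : IsCoprime M M') (hm : IsCoprime M m)
    (hV : ∃ V ∈ Γ, V 0 0 = -(m * w ^ i) ∧ V 1 0 = w ^ (i + 1)) :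
    t ∣ B 1 0 * M' * (m ^ 2 * w ^ (2 * i) - 1) := by
  obtain ⟨V, hV, h0, h1⟩ := hV
  obtain ⟨u, r, hr⟩ := hm
  obtain ⟨C, hC, hC1, hC2⟩ := exists_red_eq hM (mul_mem (zpow_mem U_mem r) hV)
  rw [red_eq_iff] at hC1
  rw [← map_one (red M'), red_eq_iff] at hC2
  have e0 : (U ^ r * V) 0 0 = -(m * w ^ i) := by
    rw [mul_entry, coe_U_zpow]
    simp [h0]
  have e1 : (U ^ r * V) 1 0 = M * (u * w ^ (i + 1)) := by
    have := congrArg (Int.cast : ℤ → O) hr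
    push_cast at this
    rw [mul_entry, coe_U_zpow]
    simp [h0, h1]
    linear_combination (-w ^ (i + 1)) * this
  have hM' : IsCoprime (M : O) (M' : O) := hM.map (Int.castRingHom O)
  have hC10 : t ∣ C 1 0 := by
    refine ht.trans ?_
    push_cast
    refine hM'.mul_dvd ?_ ?_
    · have := (hC1 1 0).add (Dvd.intro _ e1.symm)
      simpa using this
    · simpa using hC2 1 0
  have key := hB.dvd_mul_sq_sub_one hC hC10
  obtain ⟨a, ha⟩ := hC1 0 0
  obtain ⟨b, hb⟩ := ht
  rw [e0] at ha
  obtain ⟨c, hc⟩ := key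
  push_cast at hb
  refine ⟨M' * c - B 1 0 * b * a * (C 0 0 - m * w ^ i), ?_⟩
  linear_combination M' * hc + (-B 1 0 * a * (C 0 0 - m * w ^ i)) * hb -
    (B 1 0 * M' * (C 0 0 - m * w ^ i)) * ha

/-- A nonzero element of `ℤ[λ]` divides a positive integer. -/
theorem exists_nat_dvd {t : O} (ht : t ≠ 0) : ∃ N : ℕ, N ≠ 0 ∧ t ∣ N := by
  refine ⟨(QuadraticAlgebra.norm t).natAbs, by simpa using norm_ne_zero ht, ?_⟩
  have h1 : t ∣ ((QuadraticAlgebra.norm t : ℤ) : O) :=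
    ⟨star t, QuadraticAlgebra.algebraMap_norm_eq_mul_star t⟩
  rcases Int.natAbs_eq (QuadraticAlgebra.norm t) with h | h <;> rw [h] at h1
  · simpa using h1
  · simpa using h1

/-- Write `N = 2^s M` with `M` odd. At `M` the values for `m = 2` and `m = 4` generate the unit
ideal, so `t ∣ 2^s c` with `c = B 1 0`; at `2^s` the value for `m = 3` divides 20, so `t ∣ 20 M c`.
As `2^s` is prime to `5M`, only the 4 survives. -/
theorem Normalizes.dvd_four_mul (hB : Normalizes t B) (ht : t ≠ 0) : t ∣ 4 * B 1 0 := by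
  obtain ⟨N, hN, htN⟩ := exists_nat_dvd ht
  obtain ⟨s, M, hM, rfl⟩ := Nat.exists_eq_two_pow_mul_odd hN
  have h2 : IsCoprime (M : ℤ) 2 := by
    have := Nat.isCoprime_iff_coprime.2 (Nat.coprime_two_right.2 hM)
    exact_mod_cast this
  have h4 : IsCoprime (M : ℤ) 4 := h2.pow_right (n := 2)
  have h2M : IsCoprime (M : ℤ) (2 ^ s) := h2.pow_right
  have h3 : IsCoprime ((2 : ℤ) ^ s) 3 := IsCoprime.pow_left (by norm_num)
  have k1 := hB.dvd_of_first_col (M := M) (M' := 2 ^ s) (m := 2) (i := 2)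
    (by push_cast at htN ⊢; rwa [mul_comm]) h2M h2 (by simpa using exists_first_col_two)
  have k2 := hB.dvd_of_first_col (M := M) (M' := 2 ^ s) (m := 4) (i := 2)
    (by push_cast at htN ⊢; rwa [mul_comm]) h2M h4 (by simpa using exists_first_col_four)
  have k3 := hB.dvd_of_first_col (M := 2 ^ s) (M' := M) (m := 3) (i := 3)
    (by push_cast at htN ⊢; exact htN) h2M.symm h3 (by simpa using exists_first_col_three)
  have h5 : IsCoprime ((2 : ℤ) ^ s) (5 * M) :=
    IsCoprime.mul_right (IsCoprime.pow_left (by norm_num)) h2M.symm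
  obtain ⟨u, v, huv⟩ := h5
  have huv' := congrArg (Int.cast : ℤ → O) huv
  push_cast at k1 k2 k3 huv'
  have e1 : (2 ^ 2 * w ^ (2 * 2) - 1) * (16 * w + 9) - (4 ^ 2 * w ^ (2 * 2) - 1) * (4 * w + 2) =
      1 := by decide
  have e2 : (3 ^ 2 * w ^ (2 * 3) - 1) * (18 * w - 29) = 20 := by decide
  have e : 4 * B 1 0 =
      (B 1 0 * 2 ^ s * (2 ^ 2 * w ^ (2 * 2) - 1)) * ((16 * w + 9) * 4 * u) -
      (B 1 0 * 2 ^ s * (4 ^ 2 * w ^ (2 * 2) - 1)) * ((4 * w + 2) * 4 * u) +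
      (B 1 0 * M * (3 ^ 2 * w ^ (2 * 3) - 1)) * ((18 * w - 29) * v) := by
    linear_combination (-4 * B 1 0) * huv' - (4 * u * B 1 0 * 2 ^ s) * e1 - (B 1 0 * M * v) * e2
  rw [e]
  exact dvd_add (dvd_sub (k1.mul_right _) (k2.mul_right _)) (k3.mul_right _)

/-! ### The prime 2 and the integer `h` -/

theorem two_dvd_iff {z : O} : 2 ∣ z ↔ 2 ∣ z.re ∧ 2 ∣ z.im := by
  constructor
  · rintro ⟨y, rfl⟩
    rw [two_mul]
    exact ⟨⟨y.re, by simp; ring⟩, ⟨y.im, by simp; ring⟩⟩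
  · rintro ⟨⟨a, ha⟩, ⟨b, hb⟩⟩
    refine ⟨⟨a, b⟩, ?_⟩
    rw [two_mul]
    ext <;> simp [ha, hb] <;> ring

/-- The polynomial `x² - x - 1` has no root modulo 2, so 2 is inert; on coordinates this is a parity
check. -/
theorem prime_two : Prime (2 : O) := by
  refine ⟨by decide, fun h => ?_, fun x y h => ?_⟩
  · have := (two_dvd_iff.1 (h.dvd (a := 1))).1
    rw [QuadraticAlgebra.re_one] at this
    omega
  · rw [two_dvd_iff] at h ⊢
    rw [two_dvd_iff]
    simp only [QuadraticAlgebra.re_mul, QuadraticAlgebra.im_mul, one_mul,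
      ← even_iff_two_dvd] at h ⊢
    simp only [Int.even_add, Int.even_mul] at h
    tauto

/-- If `t` divides both `c²` and `4 c` then it divides `h c`, where `h` is the largest divisor
of four whose square divides `t`. -/
theorem exists_isGreatest_dvd_mul {t c : O} (ht : t ≠ 0) (h2 : t ∣ c ^ 2) (h4 : t ∣ 4 * c) :
    ∃ h : ℕ, IsGreatest {d : ℕ | d ∣ 4 ∧ (d : O) ^ 2 ∣ t} h ∧ t ∣ h * c := by
  obtain ⟨k, hk⟩ := h2
  obtain ⟨z, hz⟩ := h4
  have hdiv : ∀ {d : ℕ}, d ∣ 4 → d = 1 ∨ d = 2 ∨ d = 4 := by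
    intro d hd
    have := Nat.le_of_dvd (by norm_num) hd
    interval_cases d <;> simp_all
  -- If the prime 2 did not divide `y`, all of `2^n` would have to divide `t`. Applied with `n = 4`
  -- and `n = 2`, this halves the multiplier of `c` from 4 to 2 to 1 whenever 16, respectively 4,
  -- fails to divide `t`.
  have hstep : ∀ {y : O} {n : ℕ}, 2 ^ n * k = t * y ^ 2 → ¬ 2 ^ n ∣ t → 2 ∣ y := by
    intro y n hy hn
    by_contra h
    exact hn (prime_two.pow_dvd_of_dvd_mul_right n (fun h' => h (prime_two.dvd_of_dvd_pow h'))
      ⟨k, hy.symm⟩)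
  by_cases h16 : (2 : O) ^ 4 ∣ t
  · refine ⟨4, ⟨⟨dvd_rfl, ?_⟩, fun d hd => Nat.le_of_dvd (by norm_num) hd.1⟩, z, ?_⟩
    · convert h16 using 1
      norm_num
    · exact_mod_cast hz
  have h16' : ¬ ((4 : ℕ) : O) ^ 2 ∣ t := by
    convert h16 using 2
    norm_num
  obtain ⟨y, rfl⟩ : 2 ∣ z := by
    refine hstep (n := 4) (mul_left_cancel₀ ht ?_) h16
    linear_combination (4 * c + t * z) * hz - 16 * hk
  have hy : 2 * c = t * y := by
    apply mul_left_cancel₀ prime_two.ne_zero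
    linear_combination hz
  by_cases h4 : (2 : O) ^ 2 ∣ t
  · refine ⟨2, ⟨⟨by norm_num, by simpa using h4⟩, ?_⟩, y, by exact_mod_cast hy⟩
    rintro d ⟨hd, hd'⟩
    rcases hdiv hd with rfl | rfl | rfl
    · norm_num
    · exact le_rfl
    · exact absurd hd' h16'
  · obtain ⟨x, rfl⟩ : 2 ∣ y := by
      refine hstep (n := 2) (mul_left_cancel₀ ht ?_) h4
      linear_combination (2 * c + t * y) * hy - 4 * hk
    refine ⟨1, ⟨⟨one_dvd _, by simp⟩, ?_⟩, x, ?_⟩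
    · rintro d ⟨hd, hd'⟩
      rcases hdiv hd with rfl | rfl | rfl
      · exact le_rfl
      · exact absurd hd' (by simpa using h4)
      · exact absurd hd' h16'
    · apply mul_left_cancel₀ prime_two.ne_zero
      push_cast
      linear_combination hy

/-! ### Transfer to the groups in `PSL₂(ℝ)` -/

theorem emb_mem (z : O) : emb z ∈ Zlam :=
  add_mem (intCast_mem _ _) (mul_mem (intCast_mem _ _) (Algebra.subset_adjoin rfl))

theorem exists_emb_eq {r : ℝ} (hr : r ∈ Zlam) : ∃ z, emb z = r := by
  induction hr using Algebra.adjoin_induction with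
  | mem x hx => exact ⟨w, by rw [emb_w, Set.mem_singleton_iff.1 hx]⟩
  | algebraMap n => exact ⟨n, by simp⟩
  | add x y _ _ hx hy =>
    obtain ⟨a, rfl⟩ := hx
    obtain ⟨b, rfl⟩ := hy
    exact ⟨a + b, map_add _ _ _⟩
  | mul x y _ _ hx hy =>
    obtain ⟨a, rfl⟩ := hx
    obtain ⟨b, rfl⟩ := hy
    exact ⟨a * b, map_mul _ _ _⟩

/-- The abstract and the concrete ring `ℤ[λ]` are isomorphic. -/
noncomputable def equivZlam : O ≃+* Zlam :=
  RingEquiv.ofBijective (emb.codRestrict Zlam emb_mem)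
    ⟨fun _ _ h => emb_injective (congrArg Subtype.val h), fun x => by
      obtain ⟨z, hz⟩ := exists_emb_eq x.2
      exact ⟨z, Subtype.ext hz⟩⟩

theorem coe_equivZlam (z : O) : (equivZlam z : ℝ) = emb z := rfl

theorem proj_eq_proj {A B : SLR} (h : proj A = proj B) : B = A ∨ B = -A := by
  obtain ⟨r, hr, hr'⟩ := Matrix.SpecialLinearGroup.mem_center_iff.1 (QuotientGroup.eq.1 h)
  have hB : B = A * (A⁻¹ * B) := by group
  have hr1 : r = 1 ∨ r = -1 := by simpa using hr
  have hij : ∀ i j, (A⁻¹ * B) i j = if i = j then r else 0 := by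
    intro i j
    rw [← hr', Matrix.scalar_apply, Matrix.diagonal_apply]
  rcases hr1 with rfl | rfl
  · left
    refine Matrix.SpecialLinearGroup.ext _ _ fun i j => ?_
    rw [hB, mul_entry, hij, hij]
    fin_cases j <;> simp
  · right
    refine Matrix.SpecialLinearGroup.ext _ _ fun i j => ?_
    rw [hB, mul_entry, hij, hij, Matrix.SpecialLinearGroup.coe_neg, Matrix.neg_apply]
    fin_cases j <;> simp

theorem incl_S : incl S = matS := by
  refine Matrix.SpecialLinearGroup.ext _ _ fun i j => ?_
  rw [incl_apply]
  fin_cases i <;> fin_cases j <;> simp [S, matS]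

theorem incl_T : incl T = matT := by
  refine Matrix.SpecialLinearGroup.ext _ _ fun i j => ?_
  rw [incl_apply]
  fin_cases i <;> fin_cases j <;> simp [T, matT]

theorem G5_eq : G5 = (Γ.map incl).map proj := by
  rw [G5, Γ, MonoidHom.map_closure, MonoidHom.map_closure, Set.image_pair, Set.image_pair,
    incl_S, incl_T]

theorem proj_mem_G5_iff {A : SLR} : proj A ∈ G5 ↔ ∃ X ∈ Γ, incl X = A := by
  rw [G5_eq]
  constructor
  · rintro ⟨_, ⟨X, hX, rfl⟩, h⟩
    rcases proj_eq_proj h with rfl | rfl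
    · exact ⟨X, hX, rfl⟩
    · exact ⟨-X, neg_mem hX, incl_neg X⟩
  · rintro ⟨X, hX, rfl⟩
    exact ⟨_, ⟨X, hX, rfl⟩, rfl⟩

theorem proj_mem_G0_iff {t : O} {A : SLR} :
    proj A ∈ G0 (equivZlam t) ↔ ∃ X ∈ Γ, incl X = A ∧ t ∣ X 1 0 := by
  constructor
  · rintro ⟨hA, B, hBA, z, hz⟩
    obtain ⟨X, hX, rfl⟩ := proj_mem_G5_iff.1 hA
    refine ⟨X, hX, rfl, ?_⟩
    obtain ⟨y, rfl⟩ := equivZlam.surjective z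
    rw [coe_equivZlam, coe_equivZlam, ← map_mul] at hz
    rcases proj_eq_proj hBA with h | h
    · rw [← h, incl_apply] at hz
      exact ⟨y, emb_injective hz⟩
    · have hB : B = incl (-X) := by rw [incl_neg, h, neg_neg]
      rw [hB, incl_apply] at hz
      have := emb_injective hz
      refine ⟨-y, ?_⟩
      simp at this
      linear_combination -this
  · rintro ⟨X, hX, rfl, y, hy⟩
    refine ⟨proj_mem_G5_iff.2 ⟨X, hX, rfl⟩, incl X, rfl, equivZlam y, ?_⟩
    rw [incl_apply, hy, map_mul, coe_equivZlam, coe_equivZlam]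

/-- When `t ∣ N`, the (2,1)-entry of `X T^N X⁻¹` is a multiple of `N`, so these elements lie in
`G₀(t)` and the maximality result `ConjugatesPowers.mem` applies. -/
theorem mem_normalizer_G0 {t : O} (ht : t ≠ 0) {A : SLR}
    (hA : proj A ∈ Subgroup.normalizer (G0 (equivZlam t) : Set PSL2R)) :
    ∃ B ∈ Γ, incl B = A ∧ Normalizes t B := by
  have hconj : ∀ X ∈ Γ, t ∣ X 1 0 → ∃ Y ∈ Γ, incl Y = A * incl X * A⁻¹ ∧ t ∣ Y 1 0 := by
    intro X hX hX'
    have h : proj (incl X) ∈ G0 (equivZlam t) := proj_mem_G0_iff.2 ⟨X, hX, rfl, hX'⟩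
    have := (Subgroup.mem_normalizer_iff.1 hA _).1 h
    rw [← map_inv, ← map_mul, ← map_mul] at this
    exact proj_mem_G0_iff.1 this
  obtain ⟨N, hN, hdvd⟩ := exists_nat_dvd ht
  have hcomm : ConjugatesPowers N A := by
    intro X hX
    obtain ⟨Y, hY, h, -⟩ := hconj (X * T ^ N * X⁻¹)
      (mul_mem (mul_mem hX (pow_mem T_mem N)) (inv_mem hX)) (by
        have hT : ((T ^ N : SL) : Mat) = !![1, N * w; 0, 1] := by
          simpa using coe_T_zpow N
        rw [conj_entry, hT]
        simp
        exact (hdvd.mul_right w).mul_left _)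
    exact ⟨Y, hY, h⟩
  obtain ⟨B, hB, rfl⟩ := hcomm.mem hN
  refine ⟨B, hB, rfl, fun C hC hC' => ?_⟩
  obtain ⟨Y, hY, h, h'⟩ := hconj C hC hC'
  rw [← map_inv, ← map_mul, ← map_mul] at h
  rwa [← incl_injective h]

end HeckeFive

theorem theorem4p5 (τ : HeckeFive.Zlam) (hτ : τ ≠ 0) :
    ∃ h : ℕ, IsGreatest {d : ℕ | d ∣ 4 ∧ (d : HeckeFive.Zlam) ^ 2 ∣ τ} h ∧
      ∃ σ : HeckeFive.Zlam, τ = (h : HeckeFive.Zlam) * σ ∧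
        Subgroup.normalizer (HeckeFive.G0 τ : Set HeckeFive.PSL2R) ≤ HeckeFive.G0 σ := by
  obtain ⟨t, rfl⟩ := HeckeFive.equivZlam.surjective τ
  have ht : t ≠ 0 := by
    rintro rfl
    exact hτ (map_zero _)
  have hset : {d : ℕ | d ∣ 4 ∧ (d : HeckeFive.Zlam) ^ 2 ∣ HeckeFive.equivZlam t} =
      {d : ℕ | d ∣ 4 ∧ (d : HeckeFive.O) ^ 2 ∣ t} := by
    ext d
    rw [Set.mem_ofPred_eq, Set.mem_ofPred_eq, ← map_dvd_iff HeckeFive.equivZlam, map_pow,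
      map_natCast]
  rw [hset]
  -- The value `c = 0` only serves to produce `h` independently of the normalising element;
  -- uniqueness of the greatest element identifies it later with the one obtained from `B 1 0`.
  obtain ⟨h, hh, -⟩ := HeckeFive.exists_isGreatest_dvd_mul (c := 0) ht (by simp) (by simp)
  have h0 : (h : HeckeFive.O) ≠ 0 := by
    rw [Nat.cast_ne_zero]
    rintro rfl
    exact absurd hh.1.1 (by norm_num)
  obtain ⟨s, rfl⟩ : (h : HeckeFive.O) ∣ t := (dvd_pow_self _ two_ne_zero).trans hh.1.2
  refine ⟨h, hh, HeckeFive.equivZlam s, by rw [map_mul, map_natCast], fun g hg => ?_⟩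
  obtain ⟨A, rfl⟩ := QuotientGroup.mk'_surjective _ g
  obtain ⟨B, hB, rfl, hn⟩ := HeckeFive.mem_normalizer_G0 ht hg
  obtain ⟨h', hh', hdvd⟩ :=
    HeckeFive.exists_isGreatest_dvd_mul ht hn.dvd_sq (hn.dvd_four_mul ht)
  rw [hh'.unique hh] at hdvd
  exact HeckeFive.proj_mem_G0_iff.2 ⟨B, hB, rfl, (mul_dvd_mul_iff_left h0).1 hdvd⟩
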